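/- Let $\mathcal H_1,\mathcal H_2,\mathcal H_3,\mathcal H_4$ be separable Hilbert spaces over $\mathbb K\in\{\mathbb R,\mathbb C\}$, let $r\in\mathbb N$, let $M:\mathcal H_1\to\mathcal H_4$ be a Hilbert--Schmidt operator, and let $B:\mathcal H_3\to\mathcal H_4$ and $C:\mathcal H_1\to\mathcal H_2$ be bounded linear operators. For a bounded operator $T:\mathcal H\to\mathcal K$, let $P_{\overline{\operatorname{ran}T}}$ and $P_{(\ker T)^\perp}$ denote the orthogonal projections onto the closure of its range and onto the orthogonal complement of its kernel, and let $T^\dagger$ be its Moore--Penrose inverse: the (possibly unbounded) linear operator with domain $\operatorname{dom}T^\dagger=\operatorname{ran}T\oplus(\operatorname{ran}T)^\perp$ given by $T^\dagger(h+k)=(T|_{(\ker T)^\perp})^{-1}h$ for $h\in\operatorname{ran}T$, $k\in(\operatorname{ran}T)^\perp$. Compositions of partially defined operators are taken on their natural domains. For a compact operator $T$, $\sigma_1(T)\ge\sigma_2(T)\ge\cdots$ are its singular values, with $\sigma_i(T)=0$ for $i>\dim\operatorname{ran}T$. Let $\mathcal Y_r$ be the set of all bounded operators $Y:\mathcal H_1\to\mathcal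 H_4$ of rank at most $r$ such that $\operatorname{ran}Y\subset\operatorname{dom}B^\dagger$ and $$\|P_{\overline{\operatorname{ran}B}}MP_{(\ker C)^\perp}-Y\|_{HS}\le\|P_{\overline{\operatorname{ran}B}}MP_{(\ker C)^\perp}-\tilde Y\|_{HS}$$ for every bounded $\tilde Y:\mathcal H_1\to\mathcal H_4$ of rank at most $r$. Assume $\mathcal Y_r\neq\emptyset$ and put $$\Delta=\sum_{i\le r}\bigl|\sigma_i(P_{\overline{\operatorname{ran}B}}MP_{(\ker C)^\perp})\bigr|^2 .$$ 1. For every $Y\in\mathcal Y_r$, the operator $\hat X=B^\dagger YC^\dagger$ has domain $\operatorname{dom}C^\dagger$, the operator $M-B\hat XC$ is defined on all of $\mathcal H_1$ and Hilbert--Schmidt, and $$\|M-B\hat XC\|_{HS}^2=\|M\|_{HS}^2-\Delta .$$ 2. The operators $P_{\overline{\operatorname{ran}B}}MC^\dagger CM^*P_{\overline{\operatorname{ran}B}}$ and $C^\dagger CM^*P_{\overline{\operatorname{ran}B}}MC^\dagger C$ are everywhere defined and bounded, and $$\Delta=\sum_{i\le r}\sigma_i\bigl(P_{\overline{\operatorname{ran}B}}MC^\dagger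 CM^*P_{\overline{\operatorname{ran}B}}\bigr)=\sum_{i\le r}\sigma_i\bigl(C^\dagger CM^*P_{\overline{\operatorname{ran}B}}MC^\dagger C\bigr).$$ 3. If in addition $\operatorname{ran}M\subset\operatorname{dom}B^\dagger$, then $B^\dagger MC^\dagger CM^*B$ is an everywhere defined bounded operator on $\mathcal H_3$ and $$\Delta=\sum_{i\le r}\lambda_i\bigl(B^\dagger MC^\dagger CM^*B\bigr),$$ where $\lambda_i(\cdot)$ is the $i$-th largest eigenvalue counted with multiplicity, and $\lambda_i(\cdot)=0$ if there are fewer than $i$ nonzero eigenvalues. -/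

import Mathlib

open scoped InnerProductSpace

/-! ### Partially defined linear operators -/

section PartialOperators

variable {R E F G : Type*} [Ring R] [AddCommGroup E] [Module R E] [AddCommGroup F] [Module R F]
  [AddCommGroup G] [Module R G]

/-- The natural domain `{x ∈ dom f | f x ∈ dom g}` of the composition `g f`. -/
def compDomain (g : F →ₗ.[R] G) (f : E →ₗ.[R] F) : Submodule R E :=
  (g.domain.comap f.toFun).map f.domain.subtype

theorem compDomain_le (g : F →ₗ.[R] G) (f : E →ₗ.[R] F) : compDomain g f ≤ f.domain := by
  rintro _ ⟨x, -, rfl⟩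
  exact x.2

theorem mem_of_mem_compDomain (g : F →ₗ.[R] G) (f : E →ₗ.[R] F) (x : compDomain g f) :
    (f.toFun ∘ₗ Submodule.inclusion (compDomain_le g f)) x ∈ g.domain := by
  obtain ⟨_, x, hx, rfl⟩ := x
  exact hx

/-- The composition `g f` of partially defined linear operators, on its natural domain
`{x ∈ dom f | f x ∈ dom g}`. -/
def partialComp (g : F →ₗ.[R] G) (f : E →ₗ.[R] F) : E →ₗ.[R] G where
  domain := compDomain g f
  toFun := g.toFun ∘ₗ LinearMap.codRestrict g.domain
    (f.toFun ∘ₗ Submodule.inclusion (compDomain_le g f)) (mem_of_mem_compDomain g f)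

end PartialOperators

infixr:80 " ∘ₚ " => partialComp

section HilbertSpaceOperators

variable {𝕜 H K : Type*} [RCLike 𝕜]
  [NormedAddCommGroup H] [InnerProductSpace 𝕜 H] [CompleteSpace H]
  [NormedAddCommGroup K] [InnerProductSpace 𝕜 K] [CompleteSpace K]

/-- A bounded operator, regarded as a partially defined operator with full domain. -/
def everywhere (T : H →L[𝕜] K) : H →ₗ.[𝕜] K :=
  (T : H →ₗ[𝕜] K).toPMap ⊤

/-! ### Moore–Penrose inverse -/

/-- The restriction of `T` to `(ker T)ᗮ`. -/
def restrictKerPerp (T : H →L[𝕜] K) : T.kerᗮ →ₗ[𝕜] K :=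
  (T : H →ₗ[𝕜] K).domRestrict T.kerᗮ

theorem restrictKerPerp_injective (T : H →L[𝕜] K) : Function.Injective (restrictKerPerp T) := by
  rw [injective_iff_map_eq_zero]
  intro x hx
  have h1 : (x : H) ∈ T.ker := hx
  have h2 : (x : H) ∈ T.ker ⊓ T.kerᗮ := ⟨h1, x.2⟩
  rw [Submodule.inf_orthogonal_eq_bot] at h2
  exact Subtype.ext h2

theorem range_restrictKerPerp (T : H →L[𝕜] K) :
    LinearMap.range (restrictKerPerp T) = T.range := by
  apply le_antisymm
  · rintro _ ⟨x, rfl⟩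
    exact ⟨x, rfl⟩
  · rintro _ ⟨x, rfl⟩
    have : CompleteSpace T.ker := T.isClosed_ker.completeSpace_coe
    obtain ⟨y, hy, z, hz, rfl⟩ := T.ker.exists_add_mem_mem_orthogonal x
    refine ⟨⟨z, hz⟩, ?_⟩
    have : T y = 0 := hy
    simp [restrictKerPerp, this]

/-- The inverse of the restriction of `T` to `(ker T)ᗮ`, with domain `ran T`. -/
noncomputable def restrictKerPerpInverse (T : H →L[𝕜] K) : K →ₗ.[𝕜] H where
  domain := LinearMap.range (restrictKerPerp T)
  toFun := T.kerᗮ.subtype ∘ₗ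
    (LinearEquiv.ofInjective (restrictKerPerp T) (restrictKerPerp_injective T)).symm.toLinearMap

theorem disjoint_range_orthogonal (T : H →L[𝕜] K) :
    Disjoint (restrictKerPerpInverse T).domain ((0 : K →ₗ[𝕜] H).toPMap T.rangeᗮ).domain := by
  change Disjoint (LinearMap.range (restrictKerPerp T)) T.rangeᗮ
  rw [range_restrictKerPerp]
  exact Submodule.orthogonal_disjoint _

/-- The Moore–Penrose inverse of a bounded operator `T`: the (in general unbounded) operator with
domain `ran T ⊕ (ran T)ᗮ` which inverts `T|_{(ker T)ᗮ}` on `ran T` and vanishes on `(ran T)ᗮ`. -/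
noncomputable def moorePenrose (T : H →L[𝕜] K) : K →ₗ.[𝕜] H :=
  (restrictKerPerpInverse T).sup ((0 : K →ₗ[𝕜] H).toPMap T.rangeᗮ)
    (LinearPMap.sup_h_of_disjoint _ _ (disjoint_range_orthogonal T))

theorem moorePenrose_domain (T : H →L[𝕜] K) : (moorePenrose T).domain = T.range ⊔ T.rangeᗮ := by
  change LinearMap.range (restrictKerPerp T) ⊔ T.rangeᗮ = _
  rw [range_restrictKerPerp]

/-! ### Orthogonal projections -/

/-- The orthogonal projection of `K` onto the closure of `ran T`. -/
noncomputable def projClosureRange (T : H →L[𝕜] K) : K →L[𝕜] K :=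
  T.range.topologicalClosure.starProjection

/-- The orthogonal projection of `H` onto `(ker T)ᗮ`. -/
noncomputable def projKerPerp (T : H →L[𝕜] K) : H →L[𝕜] H :=
  T.kerᗮ.starProjection

/-! ### Hilbert–Schmidt operators -/

/-- `T` is Hilbert–Schmidt: `∑ ‖T bᵢ‖²` is finite for some orthonormal basis `b` of `H`. -/
def IsHilbertSchmidt (T : H →L[𝕜] K) : Prop :=
  ∃ (w : Set H) (b : HilbertBasis w 𝕜 H), Summable fun i => ‖T (b i)‖ ^ 2

/-- The Hilbert–Schmidt norm `(∑ ‖T bᵢ‖²)^{1/2}` of a Hilbert–Schmidt operator, computed in one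
orthonormal basis `b` of `H` (it does not depend on the basis). -/
noncomputable def hilbertSchmidtNorm (T : H →L[𝕜] K) : ℝ :=
  √(∑' i, ‖T ((exists_hilbertBasis 𝕜 H).choose_spec.choose i)‖ ^ 2)

/-! ### Singular values and eigenvalues -/

/-- `σ 0 ≥ σ 1 ≥ ⋯ ≥ 0` is the sequence of singular values of an operator `T`, extended by `0`
if `T` has finite rank: there are orthonormal systems `e` in `H` and `f` in `K`, indexed by
`{i | 0 < σ i}`, with `T h = ∑ σᵢ ⟨h, eᵢ⟩ fᵢ` for all `h` (a singular value decomposition). -/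
def IsSingularValueSequence (T : H →L[𝕜] K) (σ : ℕ → ℝ) : Prop :=
  Antitone σ ∧ (∀ i, 0 ≤ σ i) ∧
    ∃ (e : {i // 0 < σ i} → H) (f : {i // 0 < σ i} → K), Orthonormal 𝕜 e ∧ Orthonormal 𝕜 f ∧
      ∀ h : H, HasSum (fun i : {i // 0 < σ i} => ((σ (i : ℕ) : 𝕜) * ⟪e i, h⟫_𝕜) • f i) (T h)

open Classical in
/-- The singular values of a compact operator in nonincreasing order, extended by `0` beyond the
rank, and indexed from `0`. -/
noncomputable def singularValue (T : H →L[𝕜] K) : ℕ → ℝ :=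
  if h : ∃ σ, IsSingularValueSequence T σ then h.choose else 0

/-- `l 0 ≥ l 1 ≥ ⋯ ≥ 0` lists all nonzero eigenvalues of `T`, each one repeated according to its
multiplicity, and is extended by `0` if there are only finitely many. -/
def IsEigenvalueSequence (T : H →L[𝕜] H) (l : ℕ → ℝ) : Prop :=
  Antitone l ∧ (∀ i, 0 ≤ l i) ∧ ∀ μ : 𝕜, μ ≠ 0 →
    {i | (l i : 𝕜) = μ}.encard =
      Cardinal.toENat (Module.rank 𝕜 (Module.End.eigenspace (T : H →ₗ[𝕜] H) μ))

open Classical in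
/-- The eigenvalues, in nonincreasing order with multiplicity and indexed from `0`, of a compact
operator all of whose eigenvalues are nonnegative reals; extended by `0` beyond the number of
nonzero eigenvalues. -/
noncomputable def largestEigenvalue (T : H →L[𝕜] H) : ℕ → ℝ :=
  if h : ∃ l, IsEigenvalueSequence T l then h.choose else 0

end HilbertSpaceOperators

/-! ### The rank-constrained approximation problem -/

section Problem

variable {𝕜 H₁ H₂ H₃ H₄ : Type*} [RCLike 𝕜]
  [NormedAddCommGroup H₁] [InnerProductSpace 𝕜 H₁] [CompleteSpace H₁]
  [NormedAddCommGroup H₂] [InnerProductSpace 𝕜 H₂] [CompleteSpace H₂]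
  [NormedAddCommGroup H₃] [InnerProductSpace 𝕜 H₃] [CompleteSpace H₃]
  [NormedAddCommGroup H₄] [InnerProductSpace 𝕜 H₄] [CompleteSpace H₄]

/-- `P_{cl ran B} M P_{(ker C)ᗮ}`. -/
noncomputable def projectedOperator (M : H₁ →L[𝕜] H₄) (B : H₃ →L[𝕜] H₄) (C : H₁ →L[𝕜] H₂) :
    H₁ →L[𝕜] H₄ :=
  projClosureRange B ∘L M ∘L projKerPerp C

/-- The set `𝒴_r` of best Hilbert–Schmidt approximations `Y` of rank at most `r` to
`P_{cl ran B} M P_{(ker C)ᗮ}` whose range is contained in the domain of `B†`. -/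
def bestApproximations (M : H₁ →L[𝕜] H₄) (B : H₃ →L[𝕜] H₄) (C : H₁ →L[𝕜] H₂) (r : ℕ) :
    Set (H₁ →L[𝕜] H₄) :=
  {Y | (Y : H₁ →ₗ[𝕜] H₄).rank ≤ r ∧ Y.range ≤ (moorePenrose B).domain ∧
    ∀ Z : H₁ →L[𝕜] H₄, (Z : H₁ →ₗ[𝕜] H₄).rank ≤ r →
      hilbertSchmidtNorm (projectedOperator M B C - Y) ≤
        hilbertSchmidtNorm (projectedOperator M B C - Z)}

/-- `X̂ = B† Y C†`. -/
noncomputable def solution (B : H₃ →L[𝕜] H₄) (C : H₁ →L[𝕜] H₂) (Y : H₁ →L[𝕜] H₄) :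
    H₂ →ₗ.[𝕜] H₃ :=
  moorePenrose B ∘ₚ everywhere Y ∘ₚ moorePenrose C

end Problem

set_option linter.unusedSectionVars false

/-! ### The squared Hilbert–Schmidt norm with values in `[0, ∞]` -/

section HilbertSchmidt

open scoped ENNReal

variable {𝕜 H K G ι κ : Type*} [RCLike 𝕜]
  [NormedAddCommGroup H] [InnerProductSpace 𝕜 H] [CompleteSpace H]
  [NormedAddCommGroup K] [InnerProductSpace 𝕜 K] [CompleteSpace K]
  [NormedAddCommGroup G] [InnerProductSpace 𝕜 G] [CompleteSpace G]

/-! Write P for the projection onto the closure of ran B, Q for the projection onto (ker C)ᗮ, and A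
= PMQ. Since C†C = Q and BB† is P on dom B†, the operator B X̂ C is N = PYQ, defined everywhere.
Pythagoras splits ‖M - PYQ‖² into ‖P(M - Y)Q‖² = ‖A - N‖² and a remainder independent of Y
(`hsSq_sub_eq`); the case Y = 0 expresses ‖M‖² through ‖A‖² and the same remainder. By Eckart–Young
(`IsSingularValueSequence.hsSq_le`, `IsSingularValueSequence.exists_hsSq_eq`) the least value of ‖A
- Z‖² over rank at most r is ‖A‖² - Δ. It is attained by Y, hence also by N, which has rank at most
r and is no farther from A = PAQ. Subtracting gives part 1.

The operators in part 2 are AA* and A*A, whose singular values are the squares of those of A. In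
part 3 the operator T = B†MC†CM*B is bounded by the closed graph theorem and satisfies BT = AA*B.
Its range lies in (ker B)ᗮ, and that of AA* lies in ran B, so B maps eigenspaces for nonzero
eigenvalues isomorphically (`toENat_rank_eigenspace_eq`).

Singular values and eigenvalues are chosen sequences, so existence and uniqueness are needed.
Existence of the singular value decomposition comes from deflation; uniqueness of singular values
comes from Eckart–Young itself, which determines every partial sum of squares. Squared
Hilbert–Schmidt norms are computed in [0, ∞] (`hsSq`), where sums can be interchanged freely. -/

theorem enorm_sq_eq_ofReal {E : Type*} [SeminormedAddCommGroup E] (x : E) :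
    ‖x‖ₑ ^ 2 = ENNReal.ofReal (‖x‖ ^ 2) := by
  rw [ENNReal.ofReal_pow (norm_nonneg _), ofReal_norm]

theorem enorm_inner_symm {E : Type*} [SeminormedAddCommGroup E] [InnerProductSpace 𝕜 E] (x y : E) :
    ‖⟪x, y⟫_𝕜‖ₑ = ‖⟪y, x⟫_𝕜‖ₑ := by
  rw [← ofReal_norm, ← ofReal_norm, norm_inner_symm]

theorem HilbertBasis.tsum_enorm_inner_sq (b : HilbertBasis ι 𝕜 H) (x : H) :
    ∑' i, ‖⟪b i, x⟫_𝕜‖ₑ ^ 2 = ‖x‖ₑ ^ 2 := by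
  have h : HasSum (fun i => ‖⟪b i, x⟫_𝕜‖ ^ 2) (‖x‖ ^ 2) := by
    have h1 := RCLike.hasSum_re 𝕜 (b.hasSum_inner_mul_inner x x)
    rw [inner_self_eq_norm_sq (𝕜 := 𝕜)] at h1
    convert h1 using 2 with i
    rw [← inner_conj_symm x, RCLike.conj_mul]
    norm_cast
  simp_rw [enorm_sq_eq_ofReal]
  rw [← h.tsum_eq, ENNReal.ofReal_tsum_of_nonneg (fun _ => sq_nonneg _) h.summable]

/-- Parseval turns both sides into the double sum of |⟪c j, T (b i)⟫|². As the two bases are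
unrelated, applying this twice yields independence of the basis. -/
theorem tsum_enorm_sq_adjoint (T : H →L[𝕜] K) (b : HilbertBasis ι 𝕜 H) (c : HilbertBasis κ 𝕜 K) :
    ∑' i, ‖T (b i)‖ₑ ^ 2 = ∑' j, ‖T.adjoint (c j)‖ₑ ^ 2 := by
  simp_rw [← c.tsum_enorm_inner_sq (T _), ← b.tsum_enorm_inner_sq (T.adjoint _)]
  rw [ENNReal.tsum_comm]
  simp_rw [ContinuousLinearMap.adjoint_inner_right, enorm_inner_symm (𝕜 := 𝕜) (T _)]

/-- The square of the Hilbert–Schmidt norm, with value `∞` if `T` is not Hilbert–Schmidt. -/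
noncomputable def hsSq (T : H →L[𝕜] K) : ℝ≥0∞ :=
  ∑' i, ‖T ((exists_hilbertBasis 𝕜 H).choose_spec.choose i)‖ₑ ^ 2

theorem hsSq_eq_tsum (T : H →L[𝕜] K) (b : HilbertBasis ι 𝕜 H) :
    hsSq T = ∑' i, ‖T (b i)‖ₑ ^ 2 := by
  obtain ⟨w, c, -⟩ := exists_hilbertBasis 𝕜 K
  rw [hsSq, tsum_enorm_sq_adjoint T _ c, tsum_enorm_sq_adjoint T b c]

theorem hsSq_adjoint (T : H →L[𝕜] K) : hsSq T.adjoint = hsSq T := by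
  obtain ⟨w, c, -⟩ := exists_hilbertBasis 𝕜 K
  obtain ⟨w, b, -⟩ := exists_hilbertBasis 𝕜 H
  rw [hsSq_eq_tsum _ b, hsSq_eq_tsum _ c, tsum_enorm_sq_adjoint T b c]

/-- No summability is required: for a divergent series the real `tsum` and `toReal ∞` are both 0. -/
theorem tsum_enorm_sq_eq_toReal (T : H →L[𝕜] K) (b : HilbertBasis ι 𝕜 H) :
    ∑' i, ‖T (b i)‖ ^ 2 = (hsSq T).toReal := by
  rw [hsSq_eq_tsum T b, ENNReal.tsum_toReal_eq (fun i => by finiteness)]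
  simp

theorem hilbertSchmidtNorm_sq (T : H →L[𝕜] K) : hilbertSchmidtNorm T ^ 2 = (hsSq T).toReal := by
  rw [hilbertSchmidtNorm, Real.sq_sqrt (tsum_nonneg fun _ => sq_nonneg _), tsum_enorm_sq_eq_toReal]

theorem hilbertSchmidtNorm_nonneg (T : H →L[𝕜] K) : 0 ≤ hilbertSchmidtNorm T := Real.sqrt_nonneg _

theorem isHilbertSchmidt_iff (T : H →L[𝕜] K) : IsHilbertSchmidt T ↔ hsSq T ≠ ∞ := by
  have key : ∀ (w : Set H) (b : HilbertBasis w 𝕜 H),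
      (Summable fun i => ‖T (b i)‖ ^ 2) ↔ hsSq T ≠ ∞ := by
    intro w b
    rw [hsSq_eq_tsum T b]
    simp_rw [enorm_sq_eq_ofReal]
    refine ⟨fun h => h.tsum_ofReal_ne_top, fun h => ?_⟩
    simpa [ENNReal.toReal_ofReal] using ENNReal.summable_toReal h
  constructor
  · rintro ⟨w, b, h⟩
    exact (key w b).1 h
  · intro h
    obtain ⟨w, b, -⟩ := exists_hilbertBasis 𝕜 H
    exact ⟨w, b, (key w b).2 h⟩

/-- The last clause replaces a sum over the family by a sum over its range, so that comparison with
the extended basis becomes comparison of sums over nested sets. -/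
theorem Orthonormal.exists_hilbertBasis_tsum {v : ι → H} (hv : Orthonormal 𝕜 v) :
    ∃ (w : Set H) (b : HilbertBasis w 𝕜 H), (∀ i, b i = i) ∧ Set.range v ⊆ w ∧
      ∀ f : H → ℝ≥0∞, ∑' i, f (v i) = ∑' x : Set.range v, f x := by
  obtain ⟨w, b, hw, hb⟩ := hv.toSubtypeRange.exists_hilbertBasis_extension
  refine ⟨w, b, fun i => by rw [hb], hw, fun f => ?_⟩
  exact (Equiv.ofInjective v hv.linearIndependent.injective).tsum_eq (fun x : Set.range v => f x)

theorem Orthonormal.tsum_enorm_sq_le_hsSq {v : ι → H} (hv : Orthonormal 𝕜 v) (T : H →L[𝕜] K) :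
    ∑' i, ‖T (v i)‖ₑ ^ 2 ≤ hsSq T := by
  obtain ⟨w, b, hb, hw, h⟩ := hv.exists_hilbertBasis_tsum
  rw [hsSq_eq_tsum T b, h fun x => ‖T x‖ₑ ^ 2]
  simp_rw [hb]
  exact ENNReal.tsum_mono_subtype (fun x => ‖T x‖ₑ ^ 2) hw

theorem Orthonormal.tsum_enorm_sq_eq_hsSq {v : ι → H} (hv : Orthonormal 𝕜 v) (T : H →L[𝕜] K)
    (hT : ∀ x, (∀ i, ⟪v i, x⟫_𝕜 = 0) → T x = 0) :
    ∑' i, ‖T (v i)‖ₑ ^ 2 = hsSq T := by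
  refine le_antisymm (hv.tsum_enorm_sq_le_hsSq T) ?_
  obtain ⟨w, b, hb, hw, h⟩ := hv.exists_hilbertBasis_tsum
  rw [hsSq_eq_tsum T b, h fun x => ‖T x‖ₑ ^ 2]
  simp_rw [hb]
  rw [tsum_subtype w (fun x => ‖T x‖ₑ ^ 2), tsum_subtype _ (fun x => ‖T x‖ₑ ^ 2)]
  refine ENNReal.tsum_le_tsum fun x => ?_
  by_cases hx : x ∈ w
  · by_cases hx' : x ∈ Set.range v
    · simp [hx, hx']
    · have : T x = 0 := by
        refine hT x fun i => ?_
        have h1 := b.orthonormal.2 (i := ⟨v i, hw ⟨i, rfl⟩⟩) (j := ⟨x, hx⟩)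
          (fun h => hx' ⟨i, congrArg Subtype.val h⟩)
        simpa [hb] using h1
      simp [hx, this]
  · simp [hx]

/-! ### Hilbert–Schmidt norms and orthogonal projections. -/

theorem hsSq_eq_starProjection_add (U : Submodule 𝕜 K) [U.HasOrthogonalProjection]
    (T : H →L[𝕜] K) : hsSq T = hsSq (U.starProjection ∘L T) + hsSq (Uᗮ.starProjection ∘L T) := by
  obtain ⟨w, b, -⟩ := exists_hilbertBasis 𝕜 H
  simp_rw [hsSq_eq_tsum _ b]
  rw [← ENNReal.tsum_add]
  congr 1 with i
  simp_rw [enorm_sq_eq_ofReal]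
  rw [← ENNReal.ofReal_add (sq_nonneg _) (sq_nonneg _),
    Submodule.norm_sq_eq_add_norm_sq_starProjection (T (b i)) U]
  rfl

theorem hsSq_eq_add_starProjection (U : Submodule 𝕜 H) [U.HasOrthogonalProjection]
    (T : H →L[𝕜] K) : hsSq T = hsSq (T ∘L U.starProjection) + hsSq (T ∘L Uᗮ.starProjection) := by
  rw [← hsSq_adjoint T, hsSq_eq_starProjection_add U, ← hsSq_adjoint (T ∘L U.starProjection),
    ← hsSq_adjoint (T ∘L Uᗮ.starProjection), ContinuousLinearMap.adjoint_comp,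
    ContinuousLinearMap.adjoint_comp, (isSelfAdjoint_starProjection U).adjoint_eq,
    (isSelfAdjoint_starProjection Uᗮ).adjoint_eq]

theorem hsSq_starProjection_comp_le (U : Submodule 𝕜 K) [U.HasOrthogonalProjection]
    (T : H →L[𝕜] K) : hsSq (U.starProjection ∘L T) ≤ hsSq T := by
  rw [hsSq_eq_starProjection_add U T]
  exact le_self_add

theorem hsSq_comp_starProjection_le (U : Submodule 𝕜 H) [U.HasOrthogonalProjection]
    (T : H →L[𝕜] K) : hsSq (T ∘L U.starProjection) ≤ hsSq T := by
  rw [hsSq_eq_add_starProjection U T]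
  exact le_self_add

/-- The adjoint vanishes on Vᗮ, so a finite orthonormal basis of V computes its norm. Here T is
merely bounded. -/
theorem hsSq_starProjection_comp_ne_top (V : Submodule 𝕜 K) [FiniteDimensional 𝕜 V]
    (T : H →L[𝕜] K) : hsSq (V.starProjection ∘L T) ≠ ∞ := by
  rw [← hsSq_adjoint, ContinuousLinearMap.adjoint_comp, (isSelfAdjoint_starProjection V).adjoint_eq]
  have hv := (stdOrthonormalBasis 𝕜 V).orthonormal.comp_linearIsometry V.subtypeₗᵢ
  rw [← hv.tsum_enorm_sq_eq_hsSq, tsum_fintype]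
  · exact ENNReal.sum_ne_top.2 fun i _ => by finiteness
  · intro x hx
    have : x ∈ Vᗮ := by
      rw [Submodule.mem_orthogonal]
      intro u hu
      have h1 := (stdOrthonormalBasis 𝕜 V).sum_repr ⟨u, hu⟩
      have h2 := congrArg Subtype.val h1
      simp only [Submodule.coe_sum] at h2
      rw [← h2, sum_inner]
      refine Finset.sum_eq_zero fun i _ => ?_
      have := hx i
      rw [Submodule.coe_smul, inner_smul_left]
      exact mul_eq_zero_of_right _ this
    simp [(Submodule.starProjection_apply_eq_zero_iff V).2 this]

theorem hsSq_comp_left_le (L : K →L[𝕜] G) (T : H →L[𝕜] K) :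
    hsSq (L ∘L T) ≤ ‖L‖ₑ ^ 2 * hsSq T := by
  rw [hsSq, hsSq, ← ENNReal.tsum_mul_left]
  refine ENNReal.tsum_le_tsum fun i => ?_
  rw [← mul_pow]
  gcongr
  exact L.le_opENorm _

end HilbertSchmidt

/-! ### Best approximation of bounded rank -/

section EckartYoung

open scoped ENNReal

/-- The mass `w` beyond index r fits into the room `1 - w i` left among the first r indices, and
moving it there can only increase the sum, because `a` is largest there. -/
theorem ENNReal.tsum_mul_le_sum_range {a w : ℕ → ℝ≥0∞} (ha : Antitone a) (hw : ∀ i, w i ≤ 1)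
    {r : ℕ} (hr : ∑' i, w i ≤ r) : ∑' i, a i * w i ≤ ∑ i ∈ Finset.range r, a i := by
  have hfin : ∑ i ∈ Finset.range r, w i ≠ ∞ :=
    ((ENNReal.sum_le_tsum _).trans_lt (hr.trans_lt (by finiteness))).ne
  have htail : ∑' i, w (i + r) ≤ ∑ i ∈ Finset.range r, (1 - w i) := by
    rw [← ENNReal.add_le_add_iff_left hfin, ← Finset.sum_add_distrib]
    rw [← (ENNReal.summable (f := fun i => w (i + r))).sum_add_tsum_nat_add'] at hr
    refine hr.trans (le_of_eq ?_)
    rw [Finset.sum_congr rfl fun i _ => add_tsub_cancel_of_le (hw i)]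
    simp
  calc ∑' i, a i * w i
      = ∑ i ∈ Finset.range r, a i * w i + ∑' i, a (i + r) * w (i + r) :=
        ((ENNReal.summable (f := fun i => a (i + r) * w (i + r))).sum_add_tsum_nat_add').symm
    _ ≤ ∑ i ∈ Finset.range r, a i * w i + ∑' i, a r * w (i + r) := by
        gcongr with i
        exact ha (Nat.le_add_left r i)
    _ = ∑ i ∈ Finset.range r, a i * w i + a r * ∑' i, w (i + r) := by rw [ENNReal.tsum_mul_left]
    _ ≤ ∑ i ∈ Finset.range r, a i * w i + a r * ∑ i ∈ Finset.range r, (1 - w i) := by gcongr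
    _ ≤ ∑ i ∈ Finset.range r, a i * w i + ∑ i ∈ Finset.range r, a i * (1 - w i) := by
        rw [Finset.mul_sum]
        gcongr with i hi
        exact ha (Finset.mem_range.1 hi).le
    _ = ∑ i ∈ Finset.range r, a i := by
        rw [← Finset.sum_add_distrib]
        refine Finset.sum_congr rfl fun i _ => ?_
        rw [← mul_add, add_tsub_cancel_of_le (hw i), mul_one]

variable {𝕜 H K G ι : Type*} [RCLike 𝕜]
  [NormedAddCommGroup H] [InnerProductSpace 𝕜 H] [CompleteSpace H]
  [NormedAddCommGroup K] [InnerProductSpace 𝕜 K] [CompleteSpace K]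
  [NormedAddCommGroup G] [InnerProductSpace 𝕜 G] [CompleteSpace G]

theorem Orthonormal.tsum_enorm_inner_sq_le {f : ι → K} (hf : Orthonormal 𝕜 f) (x : K) :
    ∑' i, ‖⟪f i, x⟫_𝕜‖ₑ ^ 2 ≤ ‖x‖ₑ ^ 2 := by
  obtain ⟨w, b, hb, hw, h⟩ := hf.exists_hilbertBasis_tsum
  rw [← b.tsum_enorm_inner_sq x, h fun y => ‖⟪y, x⟫_𝕜‖ₑ ^ 2]
  simp_rw [hb]
  exact ENNReal.tsum_mono_subtype (fun y => ‖⟪y, x⟫_𝕜‖ₑ ^ 2) hw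

/-- Expand in an orthonormal basis of V, interchange the sums, and apply Bessel to each basis
vector. -/
theorem Orthonormal.tsum_enorm_starProjection_sq_le {f : ι → K} (hf : Orthonormal 𝕜 f)
    (V : Submodule 𝕜 K) [FiniteDimensional 𝕜 V] :
    ∑' i, ‖V.starProjection (f i)‖ₑ ^ 2 ≤ Module.finrank 𝕜 V := by
  have h : ∀ x, ‖V.starProjection x‖ₑ ^ 2
      = ∑ j, ‖⟪x, (stdOrthonormalBasis 𝕜 V j : K)⟫_𝕜‖ₑ ^ 2 := by
    intro x
    have h1 := (stdOrthonormalBasis 𝕜 V).sum_sq_norm_inner_right (V.orthogonalProjectionOnto x)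
    simp_rw [enorm_sq_eq_ofReal]
    rw [← ENNReal.ofReal_sum_of_nonneg (fun _ _ => sq_nonneg _)]
    congr 1
    rw [Submodule.starProjection_apply, Submodule.norm_coe, ← h1]
    refine Finset.sum_congr rfl fun j _ => ?_
    rw [Submodule.inner_orthogonalProjectionOnto_eq_of_mem_left, norm_inner_symm]
  simp_rw [h]
  rw [Summable.tsum_finsetSum fun _ _ => ENNReal.summable]
  calc ∑ j, ∑' i, ‖⟪f i, (stdOrthonormalBasis 𝕜 V j : K)⟫_𝕜‖ₑ ^ 2
      ≤ ∑ j, ‖(stdOrthonormalBasis 𝕜 V j : K)‖ₑ ^ 2 :=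
        Finset.sum_le_sum fun j _ => hf.tsum_enorm_inner_sq_le _
    _ = Module.finrank 𝕜 V := by
        have : ∀ j, ‖(stdOrthonormalBasis 𝕜 V j : K)‖ₑ = 1 := fun j => by
          rw [← ofReal_norm, Submodule.norm_coe, (stdOrthonormalBasis 𝕜 V).norm_eq_one,
            ENNReal.ofReal_one]
        simp [this]

theorem apply_of_hasSum_svd {T : H →L[𝕜] K} {s : ι → ℝ} {e : ι → H} {f : ι → K}
    (he : Orthonormal 𝕜 e)
    (h : ∀ x : H, HasSum (fun i => ((s i : 𝕜) * ⟪e i, x⟫_𝕜) • f i) (T x)) (i : ι) :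
    T (e i) = (s i : 𝕜) • f i := by
  classical
  refine (h (e i)).unique ?_
  have h1 := hasSum_ite_eq i ((s i : 𝕜) • f i)
  convert h1 using 2 with j
  rw [orthonormal_iff_ite.1 he j i]
  split_ifs with hij
  · subst hij
    simp
  · simp

theorem hsSq_comp_of_hasSum_svd {T : H →L[𝕜] K} {s : ι → ℝ} {e : ι → H} {f : ι → K}
    (he : Orthonormal 𝕜 e)
    (h : ∀ x : H, HasSum (fun i => ((s i : 𝕜) * ⟪e i, x⟫_𝕜) • f i) (T x)) (L : K →L[𝕜] G) :
    hsSq (L ∘L T) = ∑' i, ENNReal.ofReal (s i ^ 2) * ‖L (f i)‖ₑ ^ 2 := by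
  rw [← he.tsum_enorm_sq_eq_hsSq]
  · congr 1 with i
    rw [ContinuousLinearMap.comp_apply, apply_of_hasSum_svd he h, map_smul, enorm_smul, mul_pow,
      enorm_sq_eq_ofReal (s i : 𝕜), RCLike.norm_ofReal, sq_abs]
  · intro x hx
    have : T x = 0 := by
      refine (h x).unique ?_
      simp [hx, hasSum_zero]
    simp [this]

theorem LinearMap.finite_range_of_rank_le {Z : H →ₗ[𝕜] K} {r : ℕ} (hZ : Z.rank ≤ r) :
    FiniteDimensional 𝕜 (LinearMap.range Z) :=
  Module.rank_lt_aleph0_iff.1 (hZ.trans_lt (Cardinal.natCast_lt_aleph0))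

/-- Extending the left singular vectors by 0 to all of ℕ puts the sum in the form needed for
`ENNReal.tsum_mul_le_sum_range`. -/
theorem IsSingularValueSequence.hsSq_comp {T : H →L[𝕜] K} {σ : ℕ → ℝ}
    (hσ : IsSingularValueSequence T σ) :
    ∃ f : ℕ → K, Orthonormal 𝕜 (fun i : {i // 0 < σ i} => f i) ∧ (∀ i, ¬ 0 < σ i → f i = 0) ∧
      ∀ {V : Submodule 𝕜 K} [V.HasOrthogonalProjection], hsSq (V.starProjection ∘L T)
        = ∑' i, ENNReal.ofReal (σ i ^ 2) * ‖V.starProjection (f i)‖ₑ ^ 2 := by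
  classical
  obtain ⟨-, -, e, f, he, hf, h⟩ := hσ
  have hfi : ∀ i : {i // 0 < σ i}, (if hi : 0 < σ i then f ⟨i, hi⟩ else 0) = f i :=
    fun i => dif_pos i.2
  refine ⟨fun i => if hi : 0 < σ i then f ⟨i, hi⟩ else 0, ?_, fun i hi => dif_neg hi, ?_⟩
  · simpa only [hfi] using hf
  · intro V _
    rw [hsSq_comp_of_hasSum_svd (s := fun i : {i // 0 < σ i} => σ i) he h,
      ← tsum_subtype_eq_of_support_subset (s := {i | 0 < σ i})]
    · exact tsum_congr fun i => by rw [← hfi]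
    · intro i hi
      by_contra hi'
      exact hi (by simp [dif_neg (show ¬ 0 < σ i from hi')])

theorem IsSingularValueSequence.antitone_sq {T : H →L[𝕜] K} {σ : ℕ → ℝ}
    (hσ : IsSingularValueSequence T σ) : Antitone fun i => σ i ^ 2 :=
  fun _ _ hij => pow_le_pow_left₀ (hσ.2.1 _) (hσ.1 hij) 2

/-- Lower bound for the distance to operators of rank at most `r`. -/
theorem IsSingularValueSequence.hsSq_le {T : H →L[𝕜] K} {σ : ℕ → ℝ}
    (hσ : IsSingularValueSequence T σ) {r : ℕ} {Z : H →L[𝕜] K}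
    (hZ : (Z : H →ₗ[𝕜] K).rank ≤ r) :
    hsSq T ≤ hsSq (T - Z) + ∑ i ∈ Finset.range r, ENNReal.ofReal (σ i ^ 2) := by
  have hanti := hσ.antitone_sq
  obtain ⟨f, hf, hf0, h⟩ := hσ.hsSq_comp
  set V : Submodule 𝕜 K := LinearMap.range (Z : H →ₗ[𝕜] K) with hV
  have : FiniteDimensional 𝕜 V := LinearMap.finite_range_of_rank_le hZ
  have hdim : Module.finrank 𝕜 V ≤ r := Module.finrank_le_of_rank_le hZ
  have h1 : Vᗮ.starProjection ∘L T = Vᗮ.starProjection ∘L (T - Z) := by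
    ext x
    have : Vᗮ.starProjection (Z x) = 0 := by
      rw [Submodule.starProjection_apply_eq_zero_iff, Submodule.orthogonal_orthogonal]
      exact ⟨x, rfl⟩
    simp [this]
  rw [hsSq_eq_starProjection_add V T, h1, add_comm]
  refine add_le_add (hsSq_starProjection_comp_le _ _) ?_
  rw [h]
  -- The weights are ‖P_V (f i)‖², each at most 1 and with total at most dim V ≤ r.
  refine ENNReal.tsum_mul_le_sum_range (fun _ _ hij => ENNReal.ofReal_le_ofReal (hanti hij))
    (fun i => ?_) ?_
  · by_cases hi : 0 < σ i
    · refine pow_le_one₀ zero_le ?_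
      rw [← ofReal_norm, ENNReal.ofReal_le_one]
      exact (V.norm_starProjection_apply_le _).trans_eq (hf.1 ⟨i, hi⟩)
    · simp [hf0 i hi]
  · rw [← tsum_subtype_eq_of_support_subset (s := {i | 0 < σ i})]
    · exact (hf.tsum_enorm_starProjection_sq_le V).trans (by exact_mod_cast hdim)
    · intro i hi
      by_contra hi'
      exact hi (by simp [hf0 i hi'])

/-- The truncated singular value decomposition attains the lower bound. -/
theorem IsSingularValueSequence.exists_hsSq_eq {T : H →L[𝕜] K} {σ : ℕ → ℝ}
    (hσ : IsSingularValueSequence T σ) (r : ℕ) :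
    ∃ Z : H →L[𝕜] K, (Z : H →ₗ[𝕜] K).rank ≤ r ∧
      hsSq T = hsSq (T - Z) + ∑ i ∈ Finset.range r, ENNReal.ofReal (σ i ^ 2) := by
  classical
  obtain ⟨f, hf, hf0, h⟩ := hσ.hsSq_comp
  let s : Finset K := (Finset.range r).image f
  -- V is spanned by the first r left singular vectors, so P_V T is the truncated decomposition.
  let V := Submodule.span 𝕜 (s : Set K)
  refine ⟨V.starProjection ∘L T, ?_, ?_⟩
  · have hle : LinearMap.range (V.starProjection ∘L T : H →ₗ[𝕜] K) ≤ V := by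
      rintro _ ⟨x, rfl⟩
      exact Submodule.starProjection_apply_mem _ _
    calc LinearMap.rank (V.starProjection ∘L T : H →ₗ[𝕜] K) ≤ Module.rank 𝕜 V :=
          Submodule.rank_mono hle
      _ ≤ Cardinal.mk s := rank_span_le _
      _ ≤ r := by
          rw [Cardinal.mk_coe_finset]
          exact_mod_cast Finset.card_image_le.trans_eq (Finset.card_range r)
  · have h1 : T - V.starProjection ∘L T = Vᗮ.starProjection ∘L T := by
      ext x
      simp [Submodule.starProjection_orthogonal']
    have h2 : hsSq (V.starProjection ∘L T)
        = ∑ i ∈ Finset.range r, ENNReal.ofReal (σ i ^ 2) := by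
      rw [h, tsum_eq_sum (s := Finset.range r)]
      · refine Finset.sum_congr rfl fun i hi => ?_
        by_cases hi' : 0 < σ i
        · have hmem : f i ∈ V := Submodule.subset_span (Finset.mem_image_of_mem f hi)
          have hn : ‖f i‖ₑ = 1 := by
            rw [← ofReal_norm, show ‖f i‖ = 1 from hf.1 ⟨i, hi'⟩, ENNReal.ofReal_one]
          rw [Submodule.starProjection_eq_self_iff.2 hmem, hn, one_pow, mul_one]
        · simp [le_antisymm (not_lt.1 hi') (hσ.2.1 i)]
      · intro i hi
        by_cases hi' : 0 < σ i
        · have hmem : f i ∈ Vᗮ := by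
            rw [Submodule.mem_orthogonal]
            intro u hu
            induction hu using Submodule.span_induction with
            | zero => exact inner_zero_left _
            | add x y _ _ hx hy => rw [inner_add_left, hx, hy, add_zero]
            | smul a x _ hx => rw [inner_smul_left, hx, mul_zero]
            | mem x hx =>
              obtain ⟨j, hj, rfl⟩ := Finset.mem_image.1 hx
              by_cases hj' : 0 < σ j
              · refine hf.2 (i := ⟨j, hj'⟩) (j := ⟨i, hi'⟩) fun h => hi ?_
                obtain rfl : j = i := congrArg Subtype.val h
                exact hj
              · rw [hf0 j hj', inner_zero_left]
          simp [(Submodule.starProjection_apply_eq_zero_iff V).2 hmem]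
        · simp [hf0 i hi']
    rw [h1, add_comm, hsSq_eq_starProjection_add V T, h2]

/-- Apply the lower bound for `τ` to the operator attaining equality for `σ`, and conversely: all
partial sums of squares agree, hence so do all terms. -/
theorem IsSingularValueSequence.unique {T : H →L[𝕜] K} (hT : hsSq T ≠ ∞) {σ τ : ℕ → ℝ}
    (hσ : IsSingularValueSequence T σ) (hτ : IsSingularValueSequence T τ) : σ = τ := by
  have key : ∀ {σ τ : ℕ → ℝ}, IsSingularValueSequence T σ → IsSingularValueSequence T τ → ∀ r,
      ∑ i ∈ Finset.range r, σ i ^ 2 ≤ ∑ i ∈ Finset.range r, τ i ^ 2 := by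
    intro σ τ hσ hτ r
    obtain ⟨Z, hZ, h⟩ := hσ.exists_hsSq_eq r
    have h1 := hτ.hsSq_le hZ
    have hfin : hsSq (T - Z) ≠ ∞ := fun h' => hT (by rw [h, h', top_add])
    rw [h, ENNReal.add_le_add_iff_left hfin, ← ENNReal.ofReal_sum_of_nonneg fun _ _ => sq_nonneg _,
      ← ENNReal.ofReal_sum_of_nonneg fun _ _ => sq_nonneg _, ENNReal.ofReal_le_ofReal_iff
      (Finset.sum_nonneg fun _ _ => sq_nonneg _)] at h1
    exact h1
  funext n
  have h0 := fun r => le_antisymm (key hσ hτ r) (key hτ hσ r)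
  have h1 := h0 (n + 1)
  rw [Finset.sum_range_succ, Finset.sum_range_succ, h0 n, add_right_inj] at h1
  exact (pow_left_inj₀ (hσ.2.1 n) (hτ.2.1 n) two_ne_zero).1 h1

end EckartYoung

/-! ### Existence of the singular value decomposition -/

section SingularValueDecomposition

open scoped ENNReal
open Filter Topology

variable {𝕜 H K : Type*} [RCLike 𝕜]
  [NormedAddCommGroup H] [InnerProductSpace 𝕜 H] [CompleteSpace H]
  [NormedAddCommGroup K] [InnerProductSpace 𝕜 K] [CompleteSpace K]

theorem enorm_sq_le_hsSq (T : H →L[𝕜] K) : ‖T‖ₑ ^ 2 ≤ hsSq T := by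
  by_cases hT : hsSq T = ∞
  · simp [hT]
  have hunit : ∀ x : H, ‖x‖ = 1 → ‖T x‖ₑ ^ 2 ≤ hsSq T := fun x hx => by
    have hv : Orthonormal 𝕜 fun _ : Unit => x :=
      ⟨fun _ => hx, fun i j hij => (hij (Subsingleton.elim i j)).elim⟩
    simpa using hv.tsum_enorm_sq_le_hsSq T
  have hle : ‖T‖ ≤ √(hsSq T).toReal := by
    refine T.opNorm_le_of_unit_norm (Real.sqrt_nonneg _) fun x hx => ?_
    refine Real.le_sqrt_of_sq_le ?_
    have := ENNReal.toReal_mono hT (hunit x hx)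
    simpa using this
  have h2 : ‖T‖ ^ 2 ≤ (hsSq T).toReal := by
    rw [← Real.sq_sqrt (ENNReal.toReal_nonneg (a := hsSq T))]
    gcongr
  rw [enorm_sq_eq_ofReal]
  exact ENNReal.ofReal_le_of_le_toReal h2

theorem isCompactOperator_of_hsSq_ne_top {T : H →L[𝕜] K} (hT : hsSq T ≠ ∞) :
    IsCompactOperator T := by
  classical
  obtain ⟨w, b, -⟩ := exists_hilbertBasis 𝕜 H
  let V : Finset w → Submodule 𝕜 H := fun s => Submodule.span 𝕜 (s.image b : Finset H)
  have hVfin : ∀ s, FiniteDimensional 𝕜 (V s) := fun s => FiniteDimensional.span_finset 𝕜 _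
  have hlim : Tendsto (fun s : Finset w => T ∘L (V s).starProjection) atTop (𝓝 T) := by
    have h1 : Tendsto (fun s : Finset w => ∑ i ∈ s, ‖T (b i)‖ₑ ^ 2) atTop (𝓝 (hsSq T)) := by
      rw [hsSq_eq_tsum T b]
      exact ENNReal.summable.hasSum
    have h2 : Tendsto (fun s : Finset w => hsSq T - ∑ i ∈ s, ‖T (b i)‖ₑ ^ 2) atTop (𝓝 0) := by
      have := ENNReal.Tendsto.sub (tendsto_const_nhds (x := hsSq T)) h1 (Or.inl hT)
      rwa [tsub_self] at this
    -- The operator norm of the part of T off V s is bounded by the tail of the Hilbert–Schmidt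
    -- series, so T is a norm limit of finite-rank operators.
    have h3 : ∀ s : Finset w, ‖T ∘L (V s)ᗮ.starProjection‖ₑ ^ 2
        ≤ hsSq T - ∑ i ∈ s, ‖T (b i)‖ₑ ^ 2 := by
      intro s
      have h4 : ∑ i ∈ s, ‖T (b i)‖ₑ ^ 2 ≤ hsSq (T ∘L (V s).starProjection) := by
        rw [hsSq_eq_tsum _ b]
        refine le_trans (le_of_eq ?_) (ENNReal.sum_le_tsum s)
        refine Finset.sum_congr rfl fun i hi => ?_
        have : b i ∈ V s := Submodule.subset_span (Finset.mem_image_of_mem _ hi)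
        rw [ContinuousLinearMap.comp_apply, Submodule.starProjection_eq_self_iff.2 this]
      refine (enorm_sq_le_hsSq _).trans (ENNReal.le_sub_of_add_le_left ?_ ?_)
      · exact (h4.trans_lt ((hsSq_comp_starProjection_le _ _).trans_lt hT.lt_top)).ne
      · rw [hsSq_eq_add_starProjection (V s) T]
        gcongr
    have h5 : Tendsto (fun s : Finset w => ‖T ∘L (V s)ᗮ.starProjection‖ₑ ^ 2) atTop (𝓝 0) :=
      tendsto_of_tendsto_of_tendsto_of_le_of_le tendsto_const_nhds h2 (fun _ => zero_le) h3
    have h6 : Tendsto (fun s : Finset w => ‖T ∘L (V s)ᗮ.starProjection‖ ^ 2) atTop (𝓝 0) := by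
      have := (ENNReal.tendsto_toReal ENNReal.zero_ne_top).comp h5
      simpa [Function.comp_def] using this
    have h7 : Tendsto (fun s : Finset w => ‖T ∘L (V s)ᗮ.starProjection‖) atTop (𝓝 0) := by
      have := (Real.continuous_sqrt.tendsto 0).comp h6
      simpa [Function.comp_def, Real.sqrt_sq (norm_nonneg _)] using this
    rw [tendsto_iff_norm_sub_tendsto_zero]
    refine h7.congr fun s => ?_
    rw [norm_sub_rev]
    congr 1
    ext x
    simp [Submodule.starProjection_orthogonal']
  refine isCompactOperator_of_tendsto hlim (Eventually.of_forall fun s => ?_)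
  have : ProperSpace (V s) := FiniteDimensional.proper_rclike 𝕜 (V s)
  have hP : IsCompactOperator (V s).orthogonalProjectionOnto :=
    isCompactOperator_of_locallyCompactSpace_dom _
  exact hP.clm_comp (T ∘L (V s).subtypeL)

/-- If μ = ‖T‖² were not an eigenvalue of the compact operator T*T, then T*T - μ would be bounded
below. Expanding ‖T*Tx - μx‖² then gives ‖Tx‖² ≤ (μ - c)‖x‖² with c > 0, contradicting μ = ‖T‖². -/
theorem exists_norm_eq_one_adjoint_apply_apply {T : H →L[𝕜] K} (hT : IsCompactOperator T)
    (h0 : T ≠ 0) : ∃ e : H, ‖e‖ = 1 ∧ T.adjoint (T e) = ((‖T‖ ^ 2 : ℝ) : 𝕜) • e := by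
  set μ : ℝ := ‖T‖ ^ 2 with hμ
  have hpos : 0 < ‖T‖ := norm_pos_iff.2 h0
  have hμpos : 0 < μ := by positivity
  have hμ0 : (μ : 𝕜) ≠ 0 := by exact_mod_cast hμpos.ne'
  have hS : IsCompactOperator (T.adjoint ∘L T) := hT.clm_comp T.adjoint
  by_cases hev : Module.End.HasEigenvalue ((T.adjoint ∘L T : H →L[𝕜] H) : Module.End 𝕜 H) (μ : 𝕜)
  · obtain ⟨v, hv⟩ := hev.exists_hasEigenvector
    have hv1 : T.adjoint (T v) = (μ : 𝕜) • v := hv.apply_eq_smul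
    refine ⟨((‖v‖⁻¹ : ℝ) : 𝕜) • v, ?_, ?_⟩
    · rw [norm_smul, RCLike.norm_ofReal, abs_of_nonneg (by positivity),
        inv_mul_cancel₀ (norm_ne_zero_iff.2 hv.2)]
    · rw [map_smul, map_smul, hv1, smul_comm]
  · exfalso
    obtain ⟨C, hC⟩ := hS.antilipschitz_of_not_hasEigenvalue hμ0 hev
    have key : ∀ x, ‖x‖ ^ 2 ≤ C ^ 2 * (μ * (μ * ‖x‖ ^ 2 - ‖T x‖ ^ 2)) := by
      intro x
      have h1 := hC.le_mul_dist x 0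
      rw [map_zero, dist_zero_right, dist_zero_right] at h1
      have h2 : ‖(T.adjoint ∘L T - (μ : 𝕜) • 1 : H →L[𝕜] H) x‖ ^ 2
          ≤ μ * (μ * ‖x‖ ^ 2 - ‖T x‖ ^ 2) := by
        have h3 : ‖T.adjoint (T x)‖ ^ 2 ≤ μ * ‖T x‖ ^ 2 := by
          have := T.adjoint.le_opNorm (T x)
          rw [LinearIsometryEquiv.norm_map] at this
          rw [hμ, ← mul_pow]
          gcongr
        have h4 : RCLike.re ⟪T.adjoint (T x), (μ : 𝕜) • x⟫_𝕜 = μ * ‖T x‖ ^ 2 := by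
          rw [inner_smul_right, ContinuousLinearMap.adjoint_inner_left, RCLike.re_ofReal_mul,
            inner_self_eq_norm_sq]
        have h5 := norm_sub_sq (𝕜 := 𝕜) (T.adjoint (T x)) ((μ : 𝕜) • x)
        rw [h4, norm_smul, RCLike.norm_ofReal, abs_of_pos hμpos] at h5
        simp only [sub_apply, ContinuousLinearMap.comp_apply,
          smul_apply, one_apply_eq_self]
        rw [h5]
        nlinarith
      calc ‖x‖ ^ 2 ≤ (C * ‖(T.adjoint ∘L T - (μ : 𝕜) • 1 : H →L[𝕜] H) x‖) ^ 2 := by gcongr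
        _ = C ^ 2 * ‖(T.adjoint ∘L T - (μ : 𝕜) • 1 : H →L[𝕜] H) x‖ ^ 2 := mul_pow _ _ _
        _ ≤ _ := by gcongr
    have hC0 : (0 : ℝ) < C := by
      refine lt_of_le_of_ne C.2 fun h => h0 ?_
      ext x
      have := key x
      rw [← h] at this
      have hx : x = 0 := by
        rw [← norm_eq_zero]
        nlinarith [norm_nonneg x]
      simp [hx]
    set c : ℝ := (C ^ 2 * μ)⁻¹ with hc
    have hcpos : 0 < c := by positivity
    have hcm : c * (C ^ 2 * μ) = 1 := inv_mul_cancel₀ (by positivity)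
    have hbound : ∀ x, ‖T x‖ ^ 2 ≤ (μ - c) * ‖x‖ ^ 2 := by
      intro x
      have h1 := mul_le_mul_of_nonneg_left (key x) hcpos.le
      have h2 : c * (C ^ 2 * (μ * (μ * ‖x‖ ^ 2 - ‖T x‖ ^ 2))) = μ * ‖x‖ ^ 2 - ‖T x‖ ^ 2 := by
        rw [← mul_assoc, ← mul_assoc, mul_assoc c, hcm, one_mul]
      rw [h2] at h1
      linarith
    have hle : ‖T‖ ≤ √(μ - c) := by
      refine T.opNorm_le_bound (Real.sqrt_nonneg _) fun x => ?_
      have := Real.abs_le_sqrt (hbound x)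
      rwa [abs_of_nonneg (norm_nonneg _), Real.sqrt_mul' _ (sq_nonneg _),
        Real.sqrt_sq (norm_nonneg _)] at this
    have hlt : √(μ - c) < ‖T‖ := by
      rw [Real.sqrt_lt' hpos]
      linarith
    exact absurd hle (not_le.2 hlt)

/-- Successive splitting off of maximal singular values. -/
theorem exists_deflation {T : H →L[𝕜] K} (hT : hsSq T ≠ ∞) :
    ∃ (R : ℕ → H →L[𝕜] K) (e : ℕ → H), R 0 = T ∧
      (∀ n, R (n + 1) = R n ∘L (𝕜 ∙ e n)ᗮ.starProjection) ∧
      (∀ n, (R n).adjoint (R n (e n)) = ((‖R n‖ ^ 2 : ℝ) : 𝕜) • e n) ∧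
      (∀ n, R n ≠ 0 → ‖e n‖ = 1) ∧ ∀ n, R n = 0 → e n = 0 := by
  have hex : ∀ A : {A : H →L[𝕜] K // hsSq A ≠ ∞}, ∃ e : H,
      A.1.adjoint (A.1 e) = ((‖A.1‖ ^ 2 : ℝ) : 𝕜) • e ∧ (A.1 ≠ 0 → ‖e‖ = 1) ∧
        (A.1 = 0 → e = 0) := by
    intro A
    by_cases h : A.1 = 0
    · exact ⟨0, by simp, fun h' => absurd h h', fun _ => rfl⟩
    · obtain ⟨e, he, he'⟩ :=
        exists_norm_eq_one_adjoint_apply_apply (isCompactOperator_of_hsSq_ne_top A.2) h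
      exact ⟨e, he', fun _ => he, fun h' => absurd h' h⟩
  choose pick h1 h2 h3 using hex
  -- The subtype carries finiteness of the norm, so the remainder stays compact and the choice can
  -- be iterated.
  let step : {A : H →L[𝕜] K // hsSq A ≠ ∞} → {A : H →L[𝕜] K // hsSq A ≠ ∞} := fun A =>
    ⟨A.1 ∘L (𝕜 ∙ pick A)ᗮ.starProjection,
      ((hsSq_comp_starProjection_le _ _).trans_lt A.2.lt_top).ne⟩
  refine ⟨fun n => (step^[n] ⟨T, hT⟩).1, fun n => pick (step^[n] ⟨T, hT⟩), rfl, fun n => ?_,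
    fun n => h1 _, fun n => h2 _, fun n => h3 _⟩
  change (step^[n + 1] ⟨T, hT⟩).1 = _
  rw [Function.iterate_succ_apply']

/-- The singular values are ‖R n‖, with right vectors e n and left vectors T (e n) / ‖R n‖. The
remainders tend to 0 because ∑ ‖R n‖² = ∑ ‖T (e n)‖² ≤ `hsSq T`. -/
theorem exists_isSingularValueSequence {T : H →L[𝕜] K} (hT : hsSq T ≠ ∞) :
    ∃ σ, IsSingularValueSequence T σ := by
  obtain ⟨R, e, hR0, hRs, hadj, he1, he0⟩ := exists_deflation hT
  have hproj : ∀ n x, R (n + 1) x = R n x - ⟪e n, x⟫_𝕜 • R n (e n) := by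
    intro n x
    by_cases h : R n = 0
    · simp [hRs, h]
    · rw [hRs, ContinuousLinearMap.comp_apply, Submodule.starProjection_orthogonal',
        sub_apply, Submodule.starProjection_unit_singleton 𝕜 (he1 n h)]
      simp
  have hinner : ∀ n x, ⟪R n (e n), R n x⟫_𝕜 = ((‖R n‖ ^ 2 : ℝ) : 𝕜) * ⟪e n, x⟫_𝕜 := by
    intro n x
    rw [← ContinuousLinearMap.adjoint_inner_left, hadj, inner_smul_left, RCLike.conj_ofReal]
  have hnorm0 : ∀ n, R n ≠ 0 → ((‖R n‖ ^ 2 : ℝ) : 𝕜) ≠ 0 := by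
    intro n h
    have : 0 < ‖R n‖ := norm_pos_iff.2 h
    exact_mod_cast (pow_pos this 2).ne'
  have horth_of : ∀ n x, R n x = 0 → ⟪e n, x⟫_𝕜 = 0 := by
    intro n x hx
    by_cases h : R n = 0
    · rw [he0 n h, inner_zero_left]
    · have := hinner n x
      rw [hx, inner_zero_right] at this
      exact (mul_eq_zero.1 this.symm).resolve_left (hnorm0 n h)
  have hkill : ∀ n, ∀ k < n, R n (e k) = 0 := by
    intro n
    induction n with
    | zero => intro k hk; exact absurd hk (Nat.not_lt_zero k)
    | succ n ih =>
      intro k hk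
      rcases Nat.lt_succ_iff_lt_or_eq.1 hk with h | rfl
      · rw [hproj, horth_of n _ (ih k h), ih k h, zero_smul, sub_zero]
      · by_cases h : R k = 0
        · simp [hRs, h]
        · rw [hproj, inner_self_eq_norm_sq_to_K, he1 k h]
          simp
  have horth : ∀ k n, k < n → ⟪e k, e n⟫_𝕜 = 0 := fun k n h =>
    inner_eq_zero_symm.1 (horth_of n _ (hkill n k h))
  have hsame : ∀ m k, k ≤ m → R k (e m) = T (e m) := by
    intro m k
    induction k with
    | zero => intro _; rw [hR0]
    | succ k ih =>
      intro h
      rw [hproj, horth k m h, zero_smul, sub_zero, ih (Nat.le_of_succ_le h)]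
  have hTorth : ∀ k m, k < m → ⟪T (e k), T (e m)⟫_𝕜 = 0 := by
    intro k m h
    rw [← hsame k k le_rfl, ← hsame m k h.le, hinner, horth k m h, mul_zero]
  have hnormT : ∀ n, ‖T (e n)‖ = ‖R n‖ := by
    intro n
    rw [← hsame n n le_rfl]
    by_cases h : R n = 0
    · simp [h]
    · have := hinner n (e n)
      rw [inner_self_eq_norm_sq_to_K, inner_self_eq_norm_sq_to_K, he1 n h] at this
      have h2 : ‖R n (e n)‖ ^ 2 = ‖R n‖ ^ 2 := by
        have : ((‖R n (e n)‖ ^ 2 : ℝ) : 𝕜) = ((‖R n‖ ^ 2 : ℝ) : 𝕜) := by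
          simpa using this
        exact_mod_cast this
      exact (pow_left_inj₀ (norm_nonneg _) (norm_nonneg _) two_ne_zero).1 h2
  have hsum : ∀ n x, T x = R n x + ∑ k ∈ Finset.range n, ⟪e k, x⟫_𝕜 • T (e k) := by
    intro n x
    induction n with
    | zero => simp [hR0]
    | succ n ih =>
      rw [Finset.sum_range_succ, hproj, hsame n n le_rfl, ih]
      abel
  have hpos : ∀ n, 0 < ‖R n‖ → ‖e n‖ = 1 := fun n h => he1 n (norm_pos_iff.1 h)
  have he : Orthonormal 𝕜 fun i : {i // 0 < ‖R i‖} => e i := by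
    refine ⟨fun i => hpos i i.2, fun i j hij => ?_⟩
    rcases lt_or_gt_of_ne fun h => hij (Subtype.ext h) with h | h
    · exact horth _ _ h
    · exact inner_eq_zero_symm.1 (horth _ _ h)
  have hzero : ∀ n, ¬ 0 < ‖R n‖ → e n = 0 := fun n h =>
    he0 n (norm_le_zero_iff.1 (not_lt.1 h))
  have hlim : Tendsto (fun n => ‖R n‖) atTop (𝓝 0) := by
    have h1 : ∑' n, ‖R n‖ₑ ^ 2 ≠ ∞ := by
      refine ((le_of_eq ?_).trans_lt ((he.tsum_enorm_sq_le_hsSq T).trans_lt hT.lt_top)).ne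
      rw [← tsum_subtype_eq_of_support_subset (s := {i | 0 < ‖R i‖})]
      · refine tsum_congr fun i => ?_
        rw [← ofReal_norm, ← ofReal_norm, hnormT]
      · intro i hi
        by_contra hi'
        have hR : R i = 0 := norm_le_zero_iff.1 (not_lt.1 (show ¬ 0 < ‖R i‖ from hi'))
        exact hi (by simp [enorm_sq_eq_ofReal, hR])
    have h2 := (ENNReal.tendsto_toReal ENNReal.zero_ne_top).comp
      (ENNReal.tendsto_atTop_zero_of_tsum_ne_top h1)
    have := (Real.continuous_sqrt.tendsto 0).comp h2
    simpa [Function.comp_def, Real.sqrt_sq (norm_nonneg _)] using this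
  refine ⟨fun n => ‖R n‖, antitone_nat_of_succ_le fun n => ?_, fun n => norm_nonneg _,
    fun i => e i, fun i => ((‖R i‖⁻¹ : ℝ) : 𝕜) • T (e i), he, ⟨fun i => ?_, fun i j hij => ?_⟩,
    fun x => ?_⟩
  · rw [hRs]
    refine (ContinuousLinearMap.opNorm_comp_le _ _).trans ?_
    exact mul_le_of_le_one_right (norm_nonneg _) (Submodule.starProjection_norm_le _)
  · have : 0 < ‖R i‖ := i.2
    rw [norm_smul, hnormT, RCLike.norm_ofReal, abs_of_pos (by positivity),
      inv_mul_cancel₀ this.ne']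
  · have : ⟪T (e i), T (e j)⟫_𝕜 = 0 := by
      rcases lt_or_gt_of_ne fun h => hij (Subtype.ext h) with h | h
      · exact hTorth _ _ h
      · exact inner_eq_zero_symm.1 (hTorth _ _ h)
    simp [inner_smul_left, inner_smul_right, this]
  · have hterm : ∀ i : {i // 0 < ‖R i‖},
        (((‖R i‖ : ℝ) : 𝕜) * ⟪e i, x⟫_𝕜) • ((‖R i‖⁻¹ : ℝ) : 𝕜) • T (e i)
          = ⟪e i, x⟫_𝕜 • T (e i) := by
      intro i
      have : ((‖R i‖ : ℝ) : 𝕜) ≠ 0 := by exact_mod_cast i.2.ne'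
      rw [smul_smul]
      congr 1
      push_cast
      field_simp
    simp_rw [hterm]
    -- Unconditional summability comes from Bessel; the sum is then identified along initial
    -- segments, using R n x → 0.
    have hs1 : Summable fun i : {i // 0 < ‖R i‖} => ⟪e i, x⟫_𝕜 • e i := by
      have := he.orthogonalFamily.summable_iff_norm_sq_summable
        (fun i : {i // 0 < ‖R i‖} => ⟪e i, x⟫_𝕜)
      exact this.2 (he.inner_products_summable x)
    have hs2 : Summable fun i : {i // 0 < ‖R i‖} => ⟪e i, x⟫_𝕜 • T (e i) := by
      simpa [Function.comp_def] using T.summable hs1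
    have hs3 := (hasSum_subtype_iff_of_support_subset
      (f := fun i : ℕ => ⟪e i, x⟫_𝕜 • T (e i)) (s := {i | 0 < ‖R i‖}) (by
        intro i hi
        by_contra hi'
        exact hi (by simp [hzero i hi']))).1 hs2.hasSum
    have hR : Tendsto (fun n => R n x) atTop (𝓝 0) := by
      refine squeeze_zero_norm (fun n => (R n).le_opNorm x) ?_
      simpa using hlim.mul_const ‖x‖
    have hpart : Tendsto (fun n => ∑ k ∈ Finset.range n, ⟪e k, x⟫_𝕜 • T (e k)) atTop
        (𝓝 (T x)) := by
      have := (tendsto_const_nhds (x := T x)).sub hR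
      rw [sub_zero] at this
      refine this.congr fun n => ?_
      rw [sub_eq_iff_eq_add', ← hsum]
    have := tendsto_nhds_unique hs3.tendsto_sum_nat hpart
    rw [← this]
    exact hs2.hasSum

theorem isSingularValueSequence_singularValue {T : H →L[𝕜] K} (hT : hsSq T ≠ ∞) :
    IsSingularValueSequence T (singularValue T) := by
  have h := exists_isSingularValueSequence hT
  rw [singularValue, dif_pos h]
  exact h.choose_spec

end SingularValueDecomposition

/-! ### Squares of singular values and eigenvalues -/

section Eigenvalues

open scoped ENNReal

variable {𝕜 H K G ι : Type*} [RCLike 𝕜]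
  [NormedAddCommGroup H] [InnerProductSpace 𝕜 H] [CompleteSpace H]
  [NormedAddCommGroup K] [InnerProductSpace 𝕜 K] [CompleteSpace K]
  [NormedAddCommGroup G] [InnerProductSpace 𝕜 G] [CompleteSpace G]

theorem hasSum_comp_adjoint_of_svd {T : H →L[𝕜] K} {s : ι → ℝ} {e : ι → H} {f : ι → K}
    (he : Orthonormal 𝕜 e)
    (h : ∀ x : H, HasSum (fun i => ((s i : 𝕜) * ⟪e i, x⟫_𝕜) • f i) (T x)) (y : K) :
    HasSum (fun i => (((s i ^ 2 : ℝ) : 𝕜) * ⟪f i, y⟫_𝕜) • f i) ((T ∘L T.adjoint) y) := by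
  rw [ContinuousLinearMap.comp_apply]
  convert h (T.adjoint y) using 3 with i
  rw [ContinuousLinearMap.adjoint_inner_right, apply_of_hasSum_svd he h, inner_smul_left,
    RCLike.conj_ofReal, ← mul_assoc]
  push_cast
  ring

theorem hasSum_adjoint_comp_of_svd {T : H →L[𝕜] K} {s : ι → ℝ} {e : ι → H} {f : ι → K}
    (hf : Orthonormal 𝕜 f)
    (h : ∀ x : H, HasSum (fun i => ((s i : 𝕜) * ⟪e i, x⟫_𝕜) • f i) (T x)) (x : H) :
    HasSum (fun i => (((s i ^ 2 : ℝ) : 𝕜) * ⟪e i, x⟫_𝕜) • e i) ((T.adjoint ∘L T) x) := by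
  classical
  have hadj : ∀ i, T.adjoint (f i) = (s i : 𝕜) • e i := by
    intro i
    refine ext_inner_right 𝕜 fun z => ?_
    rw [ContinuousLinearMap.adjoint_inner_left, inner_smul_left, RCLike.conj_ofReal]
    refine ((h z).mapL (innerSL 𝕜 (f i))).unique ?_
    convert hasSum_ite_eq i ((s i : 𝕜) * ⟪e i, z⟫_𝕜) using 2 with j
    rw [innerSL_apply_apply, inner_smul_right, orthonormal_iff_ite.1 hf i j]
    by_cases hij : i = j
    · subst hij
      simp
    · simp [hij, Ne.symm hij]
  rw [ContinuousLinearMap.comp_apply]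
  convert (h x).mapL T.adjoint using 2 with i
  rw [map_smul, hadj, smul_smul]
  congr 1
  push_cast
  ring

theorem IsSingularValueSequence.of_hasSum {T : H →L[𝕜] K} {σ τ : ℕ → ℝ} (hanti : Antitone τ)
    (hτ : ∀ i, 0 < τ i ↔ 0 < σ i) (hτ0 : ∀ i, 0 ≤ τ i) {e : {i // 0 < σ i} → H}
    {f : {i // 0 < σ i} → K} (he : Orthonormal 𝕜 e) (hf : Orthonormal 𝕜 f)
    (h : ∀ x : H, HasSum (fun i : {i // 0 < σ i} => ((τ i : 𝕜) * ⟪e i, x⟫_𝕜) • f i) (T x)) :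
    IsSingularValueSequence T τ := by
  let φ : {i // 0 < τ i} ≃ {i // 0 < σ i} := Equiv.subtypeEquivRight hτ
  refine ⟨hanti, hτ0, e ∘ φ, f ∘ φ, he.comp _ φ.injective, hf.comp _ φ.injective, fun x => ?_⟩
  exact φ.hasSum_iff.2 (h x)

theorem IsSingularValueSequence.sq_pos_iff {T : H →L[𝕜] K} {σ : ℕ → ℝ}
    (hσ : IsSingularValueSequence T σ) (i : ℕ) : 0 < σ i ^ 2 ↔ 0 < σ i := by
  rw [_root_.sq_pos_iff, (hσ.2.1 i).lt_iff_ne', ne_eq]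

theorem IsSingularValueSequence.comp_adjoint {T : H →L[𝕜] K} {σ : ℕ → ℝ}
    (hσ : IsSingularValueSequence T σ) :
    IsSingularValueSequence (T ∘L T.adjoint) fun i => σ i ^ 2 := by
  have h2 := hσ.sq_pos_iff
  have h3 := hσ.antitone_sq
  obtain ⟨-, -, e, f, he, hf, h⟩ := hσ
  exact .of_hasSum h3 h2 (fun _ => sq_nonneg _) hf hf
    (hasSum_comp_adjoint_of_svd (s := fun i : {i // 0 < σ i} => σ i) he h)

theorem IsSingularValueSequence.adjoint_comp {T : H →L[𝕜] K} {σ : ℕ → ℝ}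
    (hσ : IsSingularValueSequence T σ) :
    IsSingularValueSequence (T.adjoint ∘L T) fun i => σ i ^ 2 := by
  have h2 := hσ.sq_pos_iff
  have h3 := hσ.antitone_sq
  obtain ⟨-, -, e, f, he, hf, h⟩ := hσ
  exact .of_hasSum h3 h2 (fun _ => sq_nonneg _) he he
    (hasSum_adjoint_comp_of_svd (s := fun i : {i // 0 < σ i} => σ i) hf h)

theorem singularValue_comp_adjoint {T : H →L[𝕜] K} (hT : hsSq T ≠ ∞) :
    singularValue (T ∘L T.adjoint) = fun i => singularValue T i ^ 2 := by
  have h : hsSq (T ∘L T.adjoint) ≠ ∞ := by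
    refine ((hsSq_comp_left_le _ _).trans_lt ?_).ne
    rw [hsSq_adjoint]
    exact ENNReal.mul_lt_top (by finiteness) hT.lt_top
  exact (isSingularValueSequence_singularValue h).unique h
    (isSingularValueSequence_singularValue hT).comp_adjoint

theorem singularValue_adjoint_comp {T : H →L[𝕜] K} (hT : hsSq T ≠ ∞) :
    singularValue (T.adjoint ∘L T) = fun i => singularValue T i ^ 2 := by
  have h : hsSq (T.adjoint ∘L T) ≠ ∞ :=
    ((hsSq_comp_left_le _ _).trans_lt (ENNReal.mul_lt_top (by finiteness) hT.lt_top)).ne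
  exact (isSingularValueSequence_singularValue h).unique h
    (isSingularValueSequence_singularValue hT).adjoint_comp

/-! ### Multiplicities of nonzero eigenvalues. -/

theorem IsSingularValueSequence.finite_le_sq {T : H →L[𝕜] K} (hT : hsSq T ≠ ∞) {σ : ℕ → ℝ}
    (hσ : IsSingularValueSequence T σ) {c : ℝ} (hc : 0 < c) : {i | c ≤ σ i ^ 2}.Finite := by
  have h : ∑' i, ENNReal.ofReal (σ i ^ 2) ≠ ∞ := by
    refine (lt_of_le_of_lt ?_ hT.lt_top).ne
    rw [ENNReal.tsum_eq_iSup_nat]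
    refine iSup_le fun r => ?_
    obtain ⟨Z, -, hZ⟩ := hσ.exists_hsSq_eq r
    rw [hZ]
    exact le_add_self
  refine (ENNReal.finite_const_le_of_tsum_ne_top h (ε := ENNReal.ofReal c)
    (ENNReal.ofReal_pos.2 hc).ne').subset fun i hi => ?_
  exact ENNReal.ofReal_le_ofReal hi

theorem encard_eq_toENat_rank_eigenspace {S : K →L[𝕜] K} {s : ι → ℝ} {f : ι → K}
    (hf : Orthonormal 𝕜 f)
    (h : ∀ x : K, HasSum (fun i => ((s i : 𝕜) * ⟪f i, x⟫_𝕜) • f i) (S x)) {μ : 𝕜} (hμ : μ ≠ 0)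
    (hfin : {i | (s i : 𝕜) = μ}.Finite) :
    {i | (s i : 𝕜) = μ}.encard =
      Cardinal.toENat (Module.rank 𝕜 (Module.End.eigenspace (S : K →ₗ[𝕜] K) μ)) := by
  classical
  have hSf := apply_of_hasSum_svd hf h
  have hspan : Module.End.eigenspace (S : K →ₗ[𝕜] K) μ
      = Submodule.span 𝕜 (f '' {i | (s i : 𝕜) = μ}) := by
    refine le_antisymm (fun x hx => ?_) (Submodule.span_le.2 ?_)
    · have hx' : S x = μ • x := Module.End.mem_eigenspace_iff.1 hx
      -- Comparing coefficients of S x and μ x shows that x is orthogonal to every f i with s i ≠ μ,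
      -- so the expansion of S x is a finite sum.
      have hcoef : ∀ i, (s i : 𝕜) * ⟪f i, x⟫_𝕜 = μ * ⟪f i, x⟫_𝕜 := by
        intro i
        rw [← inner_smul_right (f i) x μ, ← hx']
        refine HasSum.unique ?_ ((h x).mapL (innerSL 𝕜 (f i)))
        convert hasSum_ite_eq i ((s i : 𝕜) * ⟪f i, x⟫_𝕜) using 2 with j
        rw [innerSL_apply_apply, inner_smul_right, orthonormal_iff_ite.1 hf i j]
        by_cases hij : i = j
        · subst hij
          simp
        · simp [hij, Ne.symm hij]
      have hzero : ∀ i ∉ hfin.toFinset, ((s i : 𝕜) * ⟪f i, x⟫_𝕜) • f i = 0 := by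
        intro i hi
        have hi' : (s i : 𝕜) ≠ μ := by simpa using hi
        have : ⟪f i, x⟫_𝕜 = 0 := by
          by_contra hne
          exact hi' (mul_right_cancel₀ hne (hcoef i))
        simp [this]
      have hsum := (h x).unique (hasSum_sum_of_ne_finset_zero hzero)
      have hmem : S x ∈ Submodule.span 𝕜 (f '' {i | (s i : 𝕜) = μ}) := by
        rw [hsum]
        refine Submodule.sum_mem _ fun i hi => Submodule.smul_mem _ _ (Submodule.subset_span ?_)
        exact ⟨i, by simpa using hi, rfl⟩
      rw [hx'] at hmem
      exact (Submodule.smul_mem_iff _ hμ).1 hmem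
    · rintro _ ⟨i, hi, rfl⟩
      have hi' : (s i : 𝕜) = μ := hi
      rw [SetLike.mem_coe, Module.End.mem_eigenspace_iff, ← hi']
      exact hSf i
  rw [hspan, rank_span_set (hf.linearIndependent.linearIndepOn_id.mono (Set.image_subset_range _ _))]
  exact (hf.linearIndependent.injective.encard_image _).symm

theorem IsSingularValueSequence.encard_sq_eq {T : H →L[𝕜] K} (hT : hsSq T ≠ ∞) {σ : ℕ → ℝ}
    (hσ : IsSingularValueSequence T σ) {μ : 𝕜} (hμ : μ ≠ 0) :
    {i | ((σ i ^ 2 : ℝ) : 𝕜) = μ}.encard =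
      Cardinal.toENat (Module.rank 𝕜 (Module.End.eigenspace (T ∘L T.adjoint : K →ₗ[𝕜] K) μ)) := by
  have hfin : {i | ((σ i ^ 2 : ℝ) : 𝕜) = μ}.Finite := by
    refine (hσ.finite_le_sq hT (norm_pos_iff.2 hμ)).subset fun i hi => ?_
    have : ‖((σ i ^ 2 : ℝ) : 𝕜)‖ = ‖μ‖ := congrArg _ hi
    rw [RCLike.norm_ofReal, abs_of_nonneg (sq_nonneg _)] at this
    exact this.ge
  have hpos : ∀ i, ((σ i ^ 2 : ℝ) : 𝕜) = μ → 0 < σ i := by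
    intro i hi
    refine lt_of_le_of_ne (hσ.2.1 i) fun h => hμ ?_
    rw [← hi, ← h]
    simp
  obtain ⟨-, -, e, f, he, hf, h⟩ := hσ
  have himage : {i | ((σ i ^ 2 : ℝ) : 𝕜) = μ}
      = Subtype.val '' {i : {i // 0 < σ i} | ((σ i ^ 2 : ℝ) : 𝕜) = μ} := by
    ext i
    constructor
    · intro hi
      exact ⟨⟨i, hpos i hi⟩, hi, rfl⟩
    · rintro ⟨j, hj, rfl⟩
      exact hj
  rw [himage, Subtype.val_injective.encard_image]
  refine encard_eq_toENat_rank_eigenspace (s := fun i : {i // 0 < σ i} => σ i ^ 2) hf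
    (hasSum_comp_adjoint_of_svd (s := fun i : {i // 0 < σ i} => σ i) he h) hμ ?_
  rw [himage] at hfin
  exact hfin.of_finite_image Subtype.val_injective.injOn

/-- If `B` intertwines `T` and `S`, the nonzero eigenvalues of `T` and `S` have the same
multiplicities. -/
theorem toENat_rank_eigenspace_eq {T : H →L[𝕜] H} {S : K →L[𝕜] K} {B : H →L[𝕜] K}
    (hBT : ∀ x, B (T x) = S (B x)) (hT : ∀ x, T x ∈ B.kerᗮ) (hS : ∀ y, S y ∈ B.range) {μ : 𝕜}
    (hμ : μ ≠ 0) :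
    Cardinal.toENat (Module.rank 𝕜 (Module.End.eigenspace (T : H →ₗ[𝕜] H) μ)) =
      Cardinal.toENat (Module.rank 𝕜 (Module.End.eigenspace (S : K →ₗ[𝕜] K) μ)) := by
  have hinj : ∀ x ∈ B.kerᗮ, B x = 0 → x = 0 := by
    intro x hx hx0
    have : x ∈ B.ker ⊓ B.kerᗮ := ⟨hx0, hx⟩
    rwa [Submodule.inf_orthogonal_eq_bot] at this
  have hmaps : ∀ x ∈ Module.End.eigenspace (T : H →ₗ[𝕜] H) μ,
      (B : H →ₗ[𝕜] K) x ∈ Module.End.eigenspace (S : K →ₗ[𝕜] K) μ := by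
    intro x hx
    have hx' : T x = μ • x := Module.End.mem_eigenspace_iff.1 hx
    rw [Module.End.mem_eigenspace_iff]
    change S (B x) = μ • B x
    rw [← hBT, hx', map_smul]
  let φ := (B : H →ₗ[𝕜] K).restrict hmaps
  have hφ : Function.Bijective φ := by
    constructor
    · rw [injective_iff_map_eq_zero]
      rintro ⟨x, hx⟩ h
      have hx' : T x = μ • x := Module.End.mem_eigenspace_iff.1 hx
      have hB : B x = 0 := congrArg Subtype.val h
      refine Subtype.ext (hinj x ?_ hB)
      exact (Submodule.smul_mem_iff _ hμ).1 (hx' ▸ hT x)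
    · rintro ⟨y, hy⟩
      have hy' : S y = μ • y := Module.End.mem_eigenspace_iff.1 hy
      obtain ⟨x, hx⟩ := hS y
      have hx' : B x = μ • y := hx.trans hy'
      -- A preimage x of S y may have a component in ker B; applying T moves it into (ker B)ᗮ, where
      -- B is injective, at the cost of one more factor μ.
      have hBx : B ((μ ^ 2)⁻¹ • T x) = y := by
        rw [map_smul, hBT, hx', map_smul, hy', smul_smul, smul_smul]
        have : (μ ^ 2)⁻¹ * (μ * μ) = 1 := by field_simp
        rw [mul_assoc, this, one_smul]
      refine ⟨⟨(μ ^ 2)⁻¹ • T x, ?_⟩, Subtype.ext hBx⟩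
      rw [Module.End.mem_eigenspace_iff, ← sub_eq_zero]
      refine hinj _ ?_ ?_
      · exact Submodule.sub_mem _ (hT _) (Submodule.smul_mem _ _ (Submodule.smul_mem _ _ (hT _)))
      · rw [map_sub, sub_eq_zero]
        change B (T ((μ ^ 2)⁻¹ • T x)) = _
        rw [hBT, map_smul B μ, hBx, hy']
  have := (LinearEquiv.ofBijective φ hφ).lift_rank_eq
  rw [← Cardinal.toENat_lift, this, Cardinal.toENat_lift]

/-- At a first difference with m n < l n, the value l n occurs in `m` only before n, where the
sequences agree, but in `l` once more at n. The finite multiplicities would differ. -/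
theorem IsEigenvalueSequence.unique {T : H →L[𝕜] H} {l m : ℕ → ℝ} (hl : IsEigenvalueSequence T l)
    (hm : IsEigenvalueSequence T m) : l = m := by
  have key : ∀ {l m : ℕ → ℝ}, IsEigenvalueSequence T l → IsEigenvalueSequence T m → ∀ n,
      (∀ j < n, l j = m j) → ¬ m n < l n := by
    intro l m hl hm n hn hlt
    have hpos : 0 < l n := (hm.2.1 n).trans_lt hlt
    have hne : (l n : 𝕜) ≠ 0 := by exact_mod_cast hpos.ne'
    have hcard := (hl.2.2 _ hne).trans (hm.2.2 _ hne).symm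
    have hsub : {i | (m i : 𝕜) = l n} ⊆ {i | (l i : 𝕜) = l n} ∩ Set.Iio n := by
      intro i hi
      have hi' : m i = l n := by exact_mod_cast (show (m i : 𝕜) = l n from hi)
      have hin : i < n := by
        by_contra h
        exact absurd (hm.1 (not_lt.1 h)) (not_le.2 (hi' ▸ hlt))
      exact ⟨by rw [Set.mem_ofPred_eq, hn i hin, hi'], hin⟩
    have hss : {i | (m i : 𝕜) = l n} ⊂ {i | (l i : 𝕜) = l n} := by
      refine ⟨hsub.trans Set.inter_subset_left, fun h => ?_⟩
      exact lt_irrefl n (hsub (h (show (l n : 𝕜) = l n from rfl))).2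
    have hfin : {i | (m i : 𝕜) = l n}.Finite :=
      (Set.finite_Iio n).subset (hsub.trans Set.inter_subset_right)
    exact absurd hcard (hfin.encard_lt_encard hss).ne'
  funext n
  induction n using Nat.strong_induction_on with
  | _ n ih =>
    exact le_antisymm (not_lt.1 (key hl hm n ih))
      (not_lt.1 (key hm hl n fun j hj => (ih j hj).symm))

theorem IsEigenvalueSequence.largestEigenvalue_eq {T : H →L[𝕜] H} {l : ℕ → ℝ}
    (hl : IsEigenvalueSequence T l) : largestEigenvalue T = l := by
  have h : ∃ l, IsEigenvalueSequence T l := ⟨l, hl⟩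
  rw [largestEigenvalue, dif_pos h]
  exact h.choose_spec.unique hl

end Eigenvalues

/-! ### Compositions with everywhere defined operators and Moore–Penrose inverses -/

section PartialOperatorLemmas

variable {R E F G : Type*} [Ring R] [AddCommGroup E] [Module R E] [AddCommGroup F] [Module R F]
  [AddCommGroup G] [Module R G]

theorem mem_partialComp_domain {g : F →ₗ.[R] G} {f : E →ₗ.[R] F} {x : E} :
    x ∈ (g ∘ₚ f).domain ↔ ∃ h : x ∈ f.domain, f ⟨x, h⟩ ∈ g.domain := by
  constructor
  · rintro ⟨y, hy, rfl⟩
    exact ⟨y.2, hy⟩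
  · rintro ⟨h, h'⟩
    exact ⟨⟨x, h⟩, h', rfl⟩

end PartialOperatorLemmas

section MoorePenrose

variable {𝕜 H K G : Type*} [RCLike 𝕜]
  [NormedAddCommGroup H] [InnerProductSpace 𝕜 H] [CompleteSpace H]
  [NormedAddCommGroup K] [InnerProductSpace 𝕜 K] [CompleteSpace K]
  [NormedAddCommGroup G] [InnerProductSpace 𝕜 G] [CompleteSpace G]

theorem partialComp_everywhere_eq {g : K →ₗ.[𝕜] G} {A : H →L[𝕜] K} {L : H →L[𝕜] G}
    (h : ∀ x, ∃ hx : A x ∈ g.domain, g ⟨A x, hx⟩ = L x) : g ∘ₚ everywhere A = everywhere L := by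
  refine LinearPMap.ext ?_ fun x hx hx' => ?_
  · refine eq_top_iff.2 fun x _ => mem_partialComp_domain.2 ⟨trivial, ?_⟩
    exact (h x).1
  · exact (h x).2

theorem everywhere_partialComp_everywhere (A : K →L[𝕜] G) (L : H →L[𝕜] K) :
    everywhere A ∘ₚ everywhere L = everywhere (A ∘L L) :=
  partialComp_everywhere_eq fun _ => ⟨trivial, rfl⟩

theorem everywhere_sub_everywhere (A L : H →L[𝕜] K) :
    everywhere A - everywhere L = everywhere (A - L) := by
  refine LinearPMap.ext ?_ fun x hx hx' => ?_
  · exact inf_top_eq _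
  · rw [LinearPMap.sub_apply]
    rfl

/-! ### Projections and values of the Moore–Penrose inverse. -/

theorem projClosureRange_eq_self {T : H →L[𝕜] K} {y : K} (hy : y ∈ T.range) :
    projClosureRange T y = y :=
  Submodule.starProjection_eq_self_iff.2 (Submodule.le_topologicalClosure _ hy)

theorem projClosureRange_apply (T : H →L[𝕜] K) (x : H) : projClosureRange T (T x) = T x :=
  projClosureRange_eq_self ⟨x, rfl⟩

theorem projClosureRange_eq_zero {T : H →L[𝕜] K} {y : K} (hy : y ∈ T.rangeᗮ) :
    projClosureRange T y = 0 := by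
  rw [projClosureRange, Submodule.starProjection_apply_eq_zero_iff,
    Submodule.orthogonal_closure]
  exact hy

theorem projKerPerp_mem (T : H →L[𝕜] K) (x : H) : projKerPerp T x ∈ T.kerᗮ :=
  Submodule.starProjection_apply_mem _ _

theorem apply_projKerPerp (T : H →L[𝕜] K) (x : H) : T (projKerPerp T x) = T x := by
  have : CompleteSpace T.ker := T.isClosed_ker.completeSpace_coe
  have h : x - projKerPerp T x ∈ T.ker := by
    have := Submodule.sub_starProjection_mem_orthogonal (K := T.kerᗮ) x
    rwa [Submodule.orthogonal_orthogonal] at this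
  have h' : T (x - projKerPerp T x) = 0 := h
  rw [map_sub, sub_eq_zero] at h'
  exact h'.symm

theorem eq_of_mem_kerPerp {T : H →L[𝕜] K} {x y : H} (hx : x ∈ T.kerᗮ) (hy : y ∈ T.kerᗮ)
    (h : T x = T y) : x = y := by
  have h1 : x - y ∈ T.ker ⊓ T.kerᗮ :=
    ⟨by change T (x - y) = 0; rw [map_sub, h, sub_self], Submodule.sub_mem _ hx hy⟩
  rw [Submodule.inf_orthogonal_eq_bot] at h1
  exact sub_eq_zero.1 h1

theorem mem_moorePenrose_domain_iff {T : H →L[𝕜] K} {y : K} :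
    y ∈ (moorePenrose T).domain ↔ projClosureRange T y ∈ T.range := by
  rw [moorePenrose_domain]
  constructor
  · intro h
    obtain ⟨a, ha, b, hb, rfl⟩ := Submodule.mem_sup.1 h
    rw [map_add, projClosureRange_eq_self ha, projClosureRange_eq_zero hb, add_zero]
    exact ha
  · intro h
    rw [← add_sub_cancel (projClosureRange T y) y]
    refine Submodule.add_mem_sup h ?_
    have := Submodule.sub_starProjection_mem_orthogonal (K := T.range.topologicalClosure) y
    rwa [Submodule.orthogonal_closure] at this

theorem restrictKerPerpInverse_apply (T : H →L[𝕜] K) (y : (restrictKerPerpInverse T).domain) :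
    restrictKerPerpInverse T y ∈ T.kerᗮ ∧ T (restrictKerPerpInverse T y) = y := by
  let φ := LinearEquiv.ofInjective (restrictKerPerp T) (restrictKerPerp_injective T)
  refine ⟨(φ.symm y).2, ?_⟩
  exact congrArg Subtype.val (φ.apply_symm_apply y)

theorem moorePenrose_apply (T : H →L[𝕜] K) (y : (moorePenrose T).domain) :
    moorePenrose T y ∈ T.kerᗮ ∧ T (moorePenrose T y) = projClosureRange T y := by
  obtain ⟨y, hy⟩ := y
  obtain ⟨a, ha, b, hb, rfl⟩ := Submodule.mem_sup.1 hy
  have h : moorePenrose T ⟨a + b, hy⟩ = restrictKerPerpInverse T ⟨a, ha⟩ + 0 :=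
    LinearPMap.sup_apply _ ⟨a, ha⟩ ⟨b, hb⟩ ⟨a + b, hy⟩ rfl
  rw [h, add_zero]
  obtain ⟨h1, h2⟩ := restrictKerPerpInverse_apply T ⟨a, ha⟩
  refine ⟨h1, ?_⟩
  have ha' : a ∈ T.range := by
    rw [← range_restrictKerPerp]
    exact ha
  rw [h2, map_add, projClosureRange_eq_self ha', projClosureRange_eq_zero hb, add_zero]

/-- These two conditions determine T†y, since T is injective on (ker T)ᗮ. -/
theorem moorePenrose_eq_of {T : H →L[𝕜] K} {x : H} {y : K} (hx : x ∈ T.kerᗮ)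
    (h : T x = projClosureRange T y) :
    ∃ hy : y ∈ (moorePenrose T).domain, moorePenrose T ⟨y, hy⟩ = x := by
  have hy : y ∈ (moorePenrose T).domain := mem_moorePenrose_domain_iff.2 ⟨x, h⟩
  obtain ⟨h1, h2⟩ := moorePenrose_apply T ⟨y, hy⟩
  exact ⟨hy, eq_of_mem_kerPerp h1 hx (h2.trans h.symm)⟩

theorem moorePenrose_apply_apply (T : H →L[𝕜] K) (x : H) :
    ∃ hx : T x ∈ (moorePenrose T).domain, moorePenrose T ⟨T x, hx⟩ = projKerPerp T x :=
  moorePenrose_eq_of (projKerPerp_mem T x) (by rw [apply_projKerPerp, projClosureRange_apply])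

theorem moorePenrose_partialComp_comp (T : H →L[𝕜] K) (A : G →L[𝕜] H) :
    moorePenrose T ∘ₚ everywhere (T ∘L A) = everywhere (projKerPerp T ∘L A) :=
  partialComp_everywhere_eq fun x => moorePenrose_apply_apply T (A x)

/-- By the closed graph theorem, `B† A` is bounded if it is everywhere defined. -/
theorem exists_moorePenrose_partialComp_eq {B : H →L[𝕜] K} {A : G →L[𝕜] K}
    (hA : ∀ x, A x ∈ (moorePenrose B).domain) :
    ∃ L : G →L[𝕜] H, moorePenrose B ∘ₚ everywhere A = everywhere L ∧
      (∀ x, moorePenrose B ⟨A x, hA x⟩ = L x) ∧ (∀ x, L x ∈ B.kerᗮ) ∧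
        ∀ x, B (L x) = projClosureRange B (A x) := by
  let L : G →ₗ[𝕜] H := (moorePenrose B).toFun ∘ₗ (A : G →ₗ[𝕜] K).codRestrict _ hA
  have hL : ∀ x, L x ∈ B.kerᗮ ∧ B (L x) = projClosureRange B (A x) := fun x =>
    moorePenrose_apply B ⟨A x, hA x⟩
  have hcont : Continuous L := by
    -- The two conditions in `hL` pass to limits and together determine L x.
    refine L.continuous_of_seq_closed_graph fun u x y hu hy => ?_
    have h1 : y ∈ B.kerᗮ :=
      (Submodule.isClosed_orthogonal _).mem_of_tendsto hy (.of_forall fun n => (hL _).1)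
    have h2 : B y = projClosureRange B (A x) := by
      refine tendsto_nhds_unique ((B.continuous.tendsto y).comp hy) ?_
      refine (((projClosureRange B ∘L A).continuous.tendsto x).comp hu).congr fun n => ?_
      exact (hL (u n)).2.symm
    exact eq_of_mem_kerPerp h1 (hL x).1 (h2.trans (hL x).2.symm)
  refine ⟨⟨L, hcont⟩, partialComp_everywhere_eq fun x => ⟨hA x, rfl⟩, fun x => rfl,
    fun x => (hL x).1, fun x => (hL x).2⟩

theorem adjoint_projClosureRange (T : H →L[𝕜] K) :
    (projClosureRange T).adjoint = projClosureRange T :=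
  (isSelfAdjoint_starProjection _).adjoint_eq

theorem adjoint_projKerPerp (T : H →L[𝕜] K) : (projKerPerp T).adjoint = projKerPerp T :=
  (isSelfAdjoint_starProjection _).adjoint_eq

theorem projClosureRange_idem (T : H →L[𝕜] K) (y : K) :
    projClosureRange T (projClosureRange T y) = projClosureRange T y :=
  Submodule.starProjection_eq_self_iff.2 (Submodule.starProjection_apply_mem _ _)

theorem projKerPerp_idem (T : H →L[𝕜] K) (x : H) :
    projKerPerp T (projKerPerp T x) = projKerPerp T x :=
  Submodule.starProjection_eq_self_iff.2 (Submodule.starProjection_apply_mem _ _)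

end MoorePenrose

/-! ### The approximation problem -/

section ProblemLemmas

open scoped ENNReal

variable {𝕜 H₁ H₂ H₃ H₄ : Type*} [RCLike 𝕜]
  [NormedAddCommGroup H₁] [InnerProductSpace 𝕜 H₁] [CompleteSpace H₁]
  [NormedAddCommGroup H₂] [InnerProductSpace 𝕜 H₂] [CompleteSpace H₂]
  [NormedAddCommGroup H₃] [InnerProductSpace 𝕜 H₃] [CompleteSpace H₃]
  [NormedAddCommGroup H₄] [InnerProductSpace 𝕜 H₄] [CompleteSpace H₄]

theorem adjoint_projectedOperator (M : H₁ →L[𝕜] H₄) (B : H₃ →L[𝕜] H₄) (C : H₁ →L[𝕜] H₂) :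
    (projectedOperator M B C).adjoint = projKerPerp C ∘L M.adjoint ∘L projClosureRange B := by
  rw [projectedOperator, ContinuousLinearMap.adjoint_comp, ContinuousLinearMap.adjoint_comp,
    adjoint_projClosureRange, adjoint_projKerPerp]
  rfl

theorem hsSq_projectedOperator_le (M : H₁ →L[𝕜] H₄) (B : H₃ →L[𝕜] H₄) (C : H₁ →L[𝕜] H₂) :
    hsSq (projectedOperator M B C) ≤ hsSq M :=
  (hsSq_starProjection_comp_le _ _).trans (hsSq_comp_starProjection_le _ _)

/-- Pythagoras for the error `M - P Y Q`, where `P` and `Q` are orthogonal projections. -/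
theorem hsSq_sub_eq (U : Submodule 𝕜 H₄) [U.HasOrthogonalProjection] (V : Submodule 𝕜 H₁)
    [V.HasOrthogonalProjection] (M Y : H₁ →L[𝕜] H₄) :
    hsSq (M - U.starProjection ∘L Y ∘L V.starProjection) =
      hsSq (U.starProjection ∘L (M - Y) ∘L V.starProjection) +
        (hsSq (U.starProjection ∘L M ∘L Vᗮ.starProjection) + hsSq (Uᗮ.starProjection ∘L M)) := by
  have hU : ∀ y, U.starProjection (U.starProjection y) = U.starProjection y := fun y =>
    Submodule.starProjection_eq_self_iff.2 (Submodule.starProjection_apply_mem _ _)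
  have hV : ∀ y, V.starProjection (V.starProjection y) = V.starProjection y := fun y =>
    Submodule.starProjection_eq_self_iff.2 (Submodule.starProjection_apply_mem _ _)
  rw [hsSq_eq_starProjection_add U, hsSq_eq_add_starProjection V (U.starProjection ∘L _), add_assoc]
  congr 1
  · congr 1
    ext x
    simp [hU, hV]
  · congr 2
    · ext x
      simp [hU, hV, Submodule.starProjection_orthogonal']
    · ext x
      simp [hU, Submodule.starProjection_orthogonal']

theorem hsSq_sub_eq_of_mem_bestApproximations {M : H₁ →L[𝕜] H₄} (hM : hsSq M ≠ ∞)
    {B : H₃ →L[𝕜] H₄} {C : H₁ →L[𝕜] H₂} {r : ℕ} {Y : H₁ →L[𝕜] H₄}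
    (hY : Y ∈ bestApproximations M B C r) :
    hsSq M = hsSq (M - projClosureRange B ∘L Y ∘L projKerPerp C) +
      ∑ i ∈ Finset.range r, ENNReal.ofReal (singularValue (projectedOperator M B C) i ^ 2) := by
  obtain ⟨hrank, -, hmin⟩ := hY
  set A := projectedOperator M B C with hA
  have hAfin : hsSq A ≠ ∞ := ((hsSq_projectedOperator_le M B C).trans_lt hM.lt_top).ne
  have hσ := isSingularValueSequence_singularValue hAfin
  -- `hilbertSchmidtNorm` is 0 on operators that are not Hilbert–Schmidt, so minimality says
  -- something about `hsSq` only once finiteness is known.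
  have hYfin : hsSq (A - Y) ≠ ∞ := by
    have : FiniteDimensional 𝕜 (LinearMap.range (Y : H₁ →ₗ[𝕜] H₄)) :=
      LinearMap.finite_range_of_rank_le hrank
    rw [hsSq_eq_starProjection_add (LinearMap.range (Y : H₁ →ₗ[𝕜] H₄))]
    have h1 : (LinearMap.range (Y : H₁ →ₗ[𝕜] H₄))ᗮ.starProjection ∘L (A - Y)
        = (LinearMap.range (Y : H₁ →ₗ[𝕜] H₄))ᗮ.starProjection ∘L A := by
      ext x
      have : (LinearMap.range (Y : H₁ →ₗ[𝕜] H₄))ᗮ.starProjection (Y x) = 0 := by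
        rw [Submodule.starProjection_apply_eq_zero_iff, Submodule.orthogonal_orthogonal]
        exact ⟨x, rfl⟩
      simp [this]
    rw [h1]
    exact ENNReal.add_ne_top.2 ⟨hsSq_starProjection_comp_ne_top _ _,
      ((hsSq_starProjection_comp_le _ _).trans_lt hAfin.lt_top).ne⟩
  have hYle : hsSq (A - Y) +
      ∑ i ∈ Finset.range r, ENNReal.ofReal (singularValue A i ^ 2) ≤ hsSq A := by
    obtain ⟨Z, hZ, hZeq⟩ := hσ.exists_hsSq_eq r
    have hZfin : hsSq (A - Z) ≠ ∞ := fun h => hAfin (by rw [hZeq, h, top_add])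
    have h1 := pow_le_pow_left₀ (hilbertSchmidtNorm_nonneg _) (hmin Z hZ) 2
    rw [hilbertSchmidtNorm_sq, hilbertSchmidtNorm_sq, ENNReal.toReal_le_toReal hYfin hZfin] at h1
    rw [hZeq]
    gcongr
  set N := projClosureRange B ∘L Y ∘L projKerPerp C with hN
  have hNrank : (N : H₁ →ₗ[𝕜] H₄).rank ≤ r :=
    calc (N : H₁ →ₗ[𝕜] H₄).rank
        ≤ (((Y ∘L projKerPerp C : H₁ →L[𝕜] H₄)) : H₁ →ₗ[𝕜] H₄).rank :=
          LinearMap.rank_comp_le_right _ _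
      _ ≤ (Y : H₁ →ₗ[𝕜] H₄).rank := LinearMap.rank_comp_le_left _ _
      _ ≤ r := hrank
  have hAN : A - N = projClosureRange B ∘L (M - Y) ∘L projKerPerp C := by
    ext x
    simp [hA, hN, projectedOperator]
  have hAN' : A - N = projClosureRange B ∘L (A - Y) ∘L projKerPerp C := by
    ext x
    simp [hA, hN, projectedOperator, projClosureRange_idem, projKerPerp_idem]
  have hNle : hsSq (A - N) ≤ hsSq (A - Y) := by
    rw [hAN']
    exact (hsSq_starProjection_comp_le _ _).trans (hsSq_comp_starProjection_le _ _)
  -- N is squeezed between the Eckart–Young lower bound and the optimal distance of Y.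
  have hNeq : hsSq A = hsSq (A - N) +
      ∑ i ∈ Finset.range r, ENNReal.ofReal (singularValue A i ^ 2) :=
    le_antisymm (hσ.hsSq_le hNrank) ((add_le_add_left hNle _).trans hYle)
  have h1 := hsSq_sub_eq B.range.topologicalClosure C.kerᗮ M Y
  have h2 := hsSq_sub_eq B.range.topologicalClosure C.kerᗮ M 0
  have h3 : B.range.topologicalClosure.starProjection ∘L M ∘L C.kerᗮ.starProjection = A := rfl
  have h4 : B.range.topologicalClosure.starProjection ∘L (M - Y) ∘L C.kerᗮ.starProjection
      = A - N := hAN.symm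
  have h5 : M - B.range.topologicalClosure.starProjection ∘L Y ∘L C.kerᗮ.starProjection
      = M - N := rfl
  rw [h4, h5] at h1
  rw [sub_zero, h3, ContinuousLinearMap.zero_comp, ContinuousLinearMap.comp_zero, sub_zero,
    hNeq] at h2
  rw [h1, h2]
  ring

theorem solution_domain {B : H₃ →L[𝕜] H₄} {C : H₁ →L[𝕜] H₂} {Y : H₁ →L[𝕜] H₄}
    (hY : Y.range ≤ (moorePenrose B).domain) :
    (solution B C Y).domain = (moorePenrose C).domain := by
  ext x
  refine ⟨fun h => ?_, fun h => ?_⟩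
  · obtain ⟨h1, -⟩ := mem_partialComp_domain.1 h
    exact (mem_partialComp_domain.1 h1).1
  · exact mem_partialComp_domain.2
      ⟨mem_partialComp_domain.2 ⟨h, trivial⟩, hY ⟨moorePenrose C ⟨x, h⟩, rfl⟩⟩

theorem everywhere_sub_solution_eq (M : H₁ →L[𝕜] H₄) {B : H₃ →L[𝕜] H₄} (C : H₁ →L[𝕜] H₂)
    {Y : H₁ →L[𝕜] H₄} (hY : Y.range ≤ (moorePenrose B).domain) :
    everywhere M - (everywhere B ∘ₚ solution B C Y ∘ₚ everywhere C) =
      everywhere (M - projClosureRange B ∘L Y ∘L projKerPerp C) := by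
  obtain ⟨L, -, hL, -, hBL⟩ :=
    exists_moorePenrose_partialComp_eq (B := B) (A := Y) fun x => hY ⟨x, rfl⟩
  have h1 : solution B C Y ∘ₚ everywhere C = everywhere (L ∘L projKerPerp C) := by
    refine partialComp_everywhere_eq fun x => ?_
    obtain ⟨hx, hx'⟩ := moorePenrose_apply_apply C x
    have hdom : C x ∈ (solution B C Y).domain := by
      rw [solution_domain hY]
      exact hx
    refine ⟨hdom, ?_⟩
    have h2 : solution B C Y ⟨C x, hdom⟩
        = moorePenrose B ⟨Y (moorePenrose C ⟨C x, hx⟩), hY ⟨_, rfl⟩⟩ := rfl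
    rw [h2, hL, hx']
    rfl
  rw [h1, everywhere_partialComp_everywhere, everywhere_sub_everywhere]
  congr 2
  ext x
  exact hBL _

theorem isEigenvalueSequence_of_comp {M : H₁ →L[𝕜] H₄} (hM : hsSq M ≠ ∞) {B : H₃ →L[𝕜] H₄}
    {C : H₁ →L[𝕜] H₂} (hMB : M.range ≤ (moorePenrose B).domain) {T : H₃ →L[𝕜] H₃}
    (hT : ∀ x, T x ∈ B.kerᗮ)
    (hBT : ∀ x, B (T x) = projClosureRange B (M (projKerPerp C (M.adjoint (B x))))) :
    IsEigenvalueSequence T fun i => singularValue (projectedOperator M B C) i ^ 2 := by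
  have hAfin : hsSq (projectedOperator M B C) ≠ ∞ :=
    ((hsSq_projectedOperator_le M B C).trans_lt hM.lt_top).ne
  have hσ := isSingularValueSequence_singularValue hAfin
  refine ⟨hσ.antitone_sq, fun _ => sq_nonneg _, fun μ hμ => ?_⟩
  rw [hσ.encard_sq_eq hAfin hμ]
  refine (toENat_rank_eigenspace_eq (B := B) (fun x => ?_) hT (fun y => ?_) hμ).symm
  · rw [hBT, adjoint_projectedOperator]
    simp [projectedOperator, projKerPerp_idem, projClosureRange_apply]
  -- AA*y has the form P M z, and M z lies in dom B†, which means P M z ∈ ran B.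
  · exact mem_moorePenrose_domain_iff.1 (hMB ⟨_, rfl⟩)

end ProblemLemmas

theorem mainTheorem5 {𝕜 H₁ H₂ H₃ H₄ : Type*} [RCLike 𝕜]
    [NormedAddCommGroup H₁] [InnerProductSpace 𝕜 H₁] [CompleteSpace H₁]
    [TopologicalSpace.SeparableSpace H₁]
    [NormedAddCommGroup H₂] [InnerProductSpace 𝕜 H₂] [CompleteSpace H₂]
    [TopologicalSpace.SeparableSpace H₂]
    [NormedAddCommGroup H₃] [InnerProductSpace 𝕜 H₃] [CompleteSpace H₃]
    [TopologicalSpace.SeparableSpace H₃]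
    [NormedAddCommGroup H₄] [InnerProductSpace 𝕜 H₄] [CompleteSpace H₄]
    [TopologicalSpace.SeparableSpace H₄]
    (r : ℕ) (M : H₁ →L[𝕜] H₄) (hM : IsHilbertSchmidt M) (B : H₃ →L[𝕜] H₄) (C : H₁ →L[𝕜] H₂)
    (hY : (bestApproximations M B C r).Nonempty)
    (Δ : ℝ) (hΔ : Δ = ∑ i ∈ Finset.range r, |singularValue (projectedOperator M B C) i| ^ 2) :
    (∀ Y ∈ bestApproximations M B C r,
      (solution B C Y).domain = (moorePenrose C).domain ∧
      ∃ E : H₁ →L[𝕜] H₄,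
        everywhere M - (everywhere B ∘ₚ solution B C Y ∘ₚ everywhere C) = everywhere E ∧
        IsHilbertSchmidt E ∧
        hilbertSchmidtNorm E ^ 2 = hilbertSchmidtNorm M ^ 2 - Δ) ∧
    (∃ T : H₄ →L[𝕜] H₄,
      everywhere (projClosureRange B) ∘ₚ everywhere M ∘ₚ moorePenrose C ∘ₚ everywhere C ∘ₚ
        everywhere M.adjoint ∘ₚ everywhere (projClosureRange B) = everywhere T ∧
      Δ = ∑ i ∈ Finset.range r, singularValue T i) ∧
    (∃ T : H₁ →L[𝕜] H₁,
      moorePenrose C ∘ₚ everywhere C ∘ₚ everywhere M.adjoint ∘ₚ everywhere (projClosureRange B) ∘ₚ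
        everywhere M ∘ₚ moorePenrose C ∘ₚ everywhere C = everywhere T ∧
      Δ = ∑ i ∈ Finset.range r, singularValue T i) ∧
    (M.range ≤ (moorePenrose B).domain →
      ∃ T : H₃ →L[𝕜] H₃,
        moorePenrose B ∘ₚ everywhere M ∘ₚ moorePenrose C ∘ₚ everywhere C ∘ₚ
          everywhere M.adjoint ∘ₚ everywhere B = everywhere T ∧
        Δ = ∑ i ∈ Finset.range r, largestEigenvalue T i) := by
  simp only [sq_abs] at hΔ
  have hMfin := (isHilbertSchmidt_iff M).1 hM
  have hAfin := ((hsSq_projectedOperator_le M B C).trans_lt hMfin.lt_top).ne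
  refine ⟨fun Y hY => ⟨solution_domain hY.2.1, _, everywhere_sub_solution_eq M C hY.2.1, ?_, ?_⟩,
    ⟨projectedOperator M B C ∘L (projectedOperator M B C).adjoint, ?_, ?_⟩,
    ⟨(projectedOperator M B C).adjoint ∘L projectedOperator M B C, ?_, ?_⟩, fun hMB => ?_⟩
  · rw [isHilbertSchmidt_iff]
    intro h
    have := hsSq_sub_eq_of_mem_bestApproximations hMfin hY
    rw [h, top_add] at this
    exact hMfin this
  · have h := hsSq_sub_eq_of_mem_bestApproximations hMfin hY
    rw [← ENNReal.ofReal_sum_of_nonneg fun _ _ => sq_nonneg _, ← hΔ] at h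
    have hE : hsSq (M - projClosureRange B ∘L Y ∘L projKerPerp C) ≠ ⊤ := fun h' =>
      hMfin (by rw [h, h', top_add])
    rw [hilbertSchmidtNorm_sq, hilbertSchmidtNorm_sq, h,
      ENNReal.toReal_add hE ENNReal.ofReal_ne_top, ENNReal.toReal_ofReal]
    · ring
    · rw [hΔ]
      exact Finset.sum_nonneg fun _ _ => sq_nonneg _
  · simp only [everywhere_partialComp_everywhere, moorePenrose_partialComp_comp]
    congr 1
    rw [adjoint_projectedOperator]
    ext x
    simp [projectedOperator, projKerPerp_idem]
  · rw [hΔ, singularValue_comp_adjoint hAfin]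
  -- The rightmost C†C has no bounded factor after it, so the composition lemma is used with the
  -- identity.
  · have hC : moorePenrose C ∘ₚ everywhere C = everywhere (projKerPerp C) :=
      moorePenrose_partialComp_comp C (ContinuousLinearMap.id 𝕜 H₁)
    simp only [hC, everywhere_partialComp_everywhere, moorePenrose_partialComp_comp]
    congr 1
    rw [adjoint_projectedOperator]
    ext x
    simp [projectedOperator, projClosureRange_idem]
  · rw [hΔ, singularValue_adjoint_comp hAfin]
  · simp only [everywhere_partialComp_everywhere, moorePenrose_partialComp_comp]
    obtain ⟨T, hT, -, hT1, hT2⟩ := exists_moorePenrose_partialComp_eq (B := B)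
      (A := M ∘L projKerPerp C ∘L M.adjoint ∘L B) fun x => hMB ⟨_, rfl⟩
    refine ⟨T, hT, ?_⟩
    rw [hΔ, (isEigenvalueSequence_of_comp hMfin hMB hT1 hT2).largestEigenvalue_eq]
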